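/- **Setting.** Consider the system $x_{t+1}=A x_t+B u_t+w_t$, $y_t=C x_t+e_t$, $x_1=0$, with arbitrary fixed disturbances, and write $v_t=(y_t,u_t)\in\mathbb R^{d_y+d_u}$. It is run with a nominal controller $\pi_0$ that accepts exogenous inputs $u^{\rm ex}_t$ and emits a signal $\eta_t\in\mathbb R^{d_\eta}$: $s_{t+1}=A_0 s_t+B_0 y_t+B_{0,u}u^{\rm ex}_t$, $u_t=C_0 s_t+D_0 y_t+u^{\rm ex}_t$, $\eta_t=C_\eta s_t+D_\eta y_t$, $s_1=0$. Let $v^{\rm nat}_t,\eta^{\rm nat}_t$ be the values for $u^{\rm ex}\equiv 0$, and let $G_{{\rm ex}\to v},G_{{\rm ex}\to\eta}$ be the closed-loop Markov operators, so that $v_t=v^{\rm nat}_t+\sum_{i\le t}G_{{\rm ex}\to v}^{[t-i]}u^{\rm ex}_i$, and likewise for $\eta$. For a Markov operator put $\|G\|_{\ell_1,\rm op}=\sum_{i\ge0}\|G^{[i]}\|_{\rm op}$ and $\psi_G(n)=\sum_{i\ge n}\|G^{[i]}\|_{\rm op}$. A decay function is a nonnegative, nonincreasing function $\mathbb N\to\mathbb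 R$. **Assumptions.** The losses $\ell_t:\mathbb R^{d_y+d_u}\to\mathbb R$ are convex, differentiable, with $0\le\ell_t(v)\le L\max\{1,\|v\|^2\}$ and $\|\nabla\ell_t(v)\|\le L\max\{1,\|v\|\}$. Both $G\in\{G_{{\rm ex}\to v},G_{{\rm ex}\to\eta}\}$ satisfy $\|G\|_{\ell_1,\rm op}\le R_{\pi_0}<\infty$ and $\psi_G\le\psi_{\pi_0}$ for a decay function $\psi_{\pi_0}$. For all $t$, $\|v^{\rm nat}_t\|,\|\eta^{\rm nat}_t\|\le R_{\rm nat}$. Also $R_{\rm nat},R_{\mathcal M}\ge1$, $T,m\ge1$, $c\ge1$, $\delta\in(0,1)$, $N\ge m+h$, and for some $m_\star\in\mathbb N$ and a decay function $\psi_\star$: $$R_{\mathcal M}\ge2R_\star,\quad m\ge2m_\star+h,\quad \psi_{\pi_0}(h+1)\le \frac{cR_{\pi_0}}{T},\quad \psi_\star(m_\star)\le\frac{cR_\star}{T}.$$ **Benchmark.** $\Pi_\star$ is the set of linear dynamic controllers $\pi$ (of any finite state dimension, started at zero) that have a conversion operator $G_{\pi_0\to\pi}$ with $\|G_{\pi_0\to\pi}\|_{\ell_1,\rm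 op}\le R_\star$ and $\psi_{G_{\pi_0\to\pi}}\le\psi_\star$; a conversion operator is a Markov operator such that the exogenous inputs $\sum_{i\le t}G_{\pi_0\to\pi}^{[t-i]}\eta^{\rm nat}_i$ make the nominal closed loop reproduce the sequence $v^\pi_t$ obtained by executing $\pi$, for all $t$. Assume $\Pi_\star\neq\emptyset$. **Algorithm.** In rounds $t\le N$ the algorithm plays exploration inputs $u^{\rm ex}_t$. It then has estimates $\widehat G_{{\rm ex}\to v},\widehat G_{{\rm ex}\to\eta}$, truncated after lag $h$ (for each lag beyond $h$ the exact Markov parameter is also allowed). For $t>N$ it plays $u^{\rm ex}_t=\sum_{i=0}^{m-1}M_t^{[i]}\widehat\eta^{\,\rm nat}_{t-i}$, where $\widehat\eta^{\,\rm nat}_t=\eta_t-\sum_{i<t}\widehat G_{{\rm ex}\to\eta}^{[t-i]}u^{\rm ex}_i$ (zero for $t\le0$), and the iterates $M_t\in\mathcal M=\{M:\sum_{i<m}\|M^{[i]}\|_{\rm op}\le R_{\mathcal M}\}$ are produced by an arbitrary black-box procedure. Let $\mathfrak e(M)$ be the vectorization of $M$, $\mathcal M_{\mathfrak e}=\mathfrak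 e(\mathcal M)$, $\mathbf z_t=\mathfrak e(M_t)$, and let $\mathbf Y_t$ be the matrix with $\mathbf Y_t\,\mathfrak e(M)=\sum_{i<m}M^{[i]}\widehat\eta^{\,\rm nat}_{t-i}$ for every $M$. Put $F_t(z_{t:t-h})=\ell_t\big(v^{\rm nat}_t+\sum_{i=0}^hG_{{\rm ex}\to v}^{[i]}\mathbf Y_{t-i}z_{t-i}\big)$, $f_t(z)=F_t(z,\dots,z)$, and $$\mathrm{ControlReg}_T=\sum_{t=1}^T\ell_t(v_t)-\inf_{\pi\in\Pi_\star}\sum_{t=1}^T\ell_t(v^\pi_t),\qquad \widehat{\mathrm{MemoryReg}}_T(z_\star)=\sum_{t=N+m+2h+1}^T\big(F_t(\mathbf z_{t:t-h})-f_t(z_\star)\big).$$ **Estimation event.** With $R_{u,\rm est}=3\sqrt{d_u+\log(1/\delta)}$, suppose that $\|u^{\rm ex}_t\|\le R_{u,\rm est}$ for $t\le N$, that $\|\widehat G_{{\rm ex}\to v}-G_{{\rm ex}\to v}\|_{\ell_1,\rm op}\le\epsilon_G$ and $\|\widehat G_{{\rm ex}\to\eta}-G_{{\rm ex}\to\eta}\|_{\ell_1,\rm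 op}\le\epsilon_G$, and that $\epsilon_G\le1/\max\{R_{u,\rm est},2R_{\mathcal M}R_{\pi_0}\}$. **Claim.** There is a universal constant $K_0>0$ such that in this situation there exists $z_\star\in\mathcal M_{\mathfrak e}$ such that, for every $\nu>0$, $$\begin{aligned}\mathrm{ControlReg}_T\le{}&\widehat{\mathrm{MemoryReg}}_T(z_\star)+\nu\sum_{t=N+m+2h+1}^T\|\mathbf Y_t(\mathbf z_t-z_\star)\|_2^2\\&+K_0LR_{\pi_0}^3(N+cm)\big(d_u+\log(1/\delta)+R_{\mathcal M}^4R_{\rm nat}^2\big)\\&+K_0LR_{\mathcal M}^3R_{\pi_0}^2R_{\rm nat}^2\,T\epsilon_G^2\Big(1+\frac{LmR_{\pi_0}^2}{\nu}\Big).\end{aligned}$$ The same holds for the static version of the algorithm, where $\pi_0$ is static feedback $u_t=Ky_t+u^{\rm ex}_t$, $\eta_t=y_t$, and a single estimate $\widehat G$ of $G_K=G_{{\rm ex}\to v}$ with $\|\widehat G-G_K\|_{\ell_1,\rm op}\le\epsilon_G$ is used, its $y$-rows serving as $\widehat G_{{\rm ex}\to\eta}$. -/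

import Mathlib

-- On matrices, `‖A‖` is the operator norm induced by the Euclidean norms.
open scoped Matrix.Norms.L2Operator

noncomputable section

namespace NonstochasticControl

/-! Time is indexed from `0`: index `t` stands for round `t + 1`, so that the rounds `1, …, T`
are the indices `t < T`, and the rounds `a + 1, …, T` are the indices `a ≤ t < T`. -/

/-- Euclidean space of dimension `n`. -/
abbrev Vec (n : ℕ) : Type := EuclideanSpace ℝ (Fin n)

/-- The space of the stacked vectors `v = (y, u)`, with the Euclidean norm. -/
abbrev VecYU (dy du : ℕ) : Type := EuclideanSpace ℝ (Fin dy ⊕ Fin du)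

/-- The stacked vector `(y, u)`. -/
def stack {dy du : ℕ} (y : Vec dy) (u : Vec du) : VecYU dy du :=
  WithLp.toLp 2 (Sum.elim (fun i => y i) (fun i => u i))

/-- Matrix-vector product on Euclidean spaces. -/
def act {ι κ : Type} [Fintype ι] [Fintype κ] (A : Matrix ι κ ℝ) (x : EuclideanSpace ℝ κ) :
    EuclideanSpace ℝ ι :=
  WithLp.toLp 2 (A.mulVec x.ofLp)

infixr:73 " *ₑ " => act

/-! ### Systems and controllers -/

/-- The system `x_{t+1} = A x_t + B u_t + w_t`, `y_t = C x_t + e_t`. -/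
structure LinearSystem (dx dy du : ℕ) where
  A : Matrix (Fin dx) (Fin dx) ℝ
  B : Matrix (Fin dx) (Fin du) ℝ
  C : Matrix (Fin dy) (Fin dx) ℝ

/-- A nominal controller `π₀`, which accepts exogenous inputs `uᵉˣ` and emits a signal `η`:
`s_{t+1} = A s_t + B y_t + Bu uᵉˣ_t`, `u_t = C s_t + D y_t + uᵉˣ_t`, `η_t = Cη s_t + Dη y_t`. -/
structure NominalController (ds dy du dη : ℕ) where
  A : Matrix (Fin ds) (Fin ds) ℝ
  B : Matrix (Fin ds) (Fin dy) ℝ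
  Bu : Matrix (Fin ds) (Fin du) ℝ
  C : Matrix (Fin du) (Fin ds) ℝ
  D : Matrix (Fin du) (Fin dy) ℝ
  Cη : Matrix (Fin dη) (Fin ds) ℝ
  Dη : Matrix (Fin dη) (Fin dy) ℝ

/-- Static feedback `u_t = K y_t + uᵉˣ_t`, with `η_t = y_t`. -/
def NominalController.static {dy du : ℕ} (K : Matrix (Fin du) (Fin dy) ℝ) :
    NominalController 0 dy du dy where
  A := 0
  B := 0
  Bu := 0
  C := 0
  D := K
  Cη := 0
  Dη := 1

/-- A linear dynamic controller `s_{t+1} = A s_t + B y_t`, `u_t = C s_t + D y_t`. -/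
structure LDC (dy du : ℕ) where
  dim : ℕ
  A : Matrix (Fin dim) (Fin dim) ℝ
  B : Matrix (Fin dim) (Fin dy) ℝ
  C : Matrix (Fin du) (Fin dim) ℝ
  D : Matrix (Fin du) (Fin dy) ℝ

/-- A control instance: the system, the nominal controller, the disturbances and the losses. -/
structure Instance (dx ds dy du dη : ℕ) where
  sys : LinearSystem dx dy du
  ctrl : NominalController ds dy du dη
  w : ℕ → Vec dx
  e : ℕ → Vec dy
  loss : ℕ → VecYU dy du → ℝ

variable {dx ds dy du dη : ℕ}

namespace Instance

/-- State `(x_t, s_t)` of the system in feedback with the nominal controller, when the exogenous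
inputs are `uex`; it starts at zero. -/
def state (P : Instance dx ds dy du dη) (uex : ℕ → Vec du) : ℕ → Vec dx × Vec ds
  | 0 => (0, 0)
  | t + 1 =>
    let x := (state P uex t).1
    let s := (state P uex t).2
    let y := P.sys.C *ₑ x + P.e t
    let u := P.ctrl.C *ₑ s + P.ctrl.D *ₑ y + uex t
    (P.sys.A *ₑ x + P.sys.B *ₑ u + P.w t, P.ctrl.A *ₑ s + P.ctrl.B *ₑ y + P.ctrl.Bu *ₑ uex t)

/-- The output `y_t` under exogenous inputs `uex`. -/
def y (P : Instance dx ds dy du dη) (uex : ℕ → Vec du) (t : ℕ) : Vec dy :=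
  P.sys.C *ₑ (P.state uex t).1 + P.e t

/-- The input `u_t` under exogenous inputs `uex`. -/
def u (P : Instance dx ds dy du dη) (uex : ℕ → Vec du) (t : ℕ) : Vec du :=
  P.ctrl.C *ₑ (P.state uex t).2 + P.ctrl.D *ₑ P.y uex t + uex t

/-- The stacked vector `v_t = (y_t, u_t)` under exogenous inputs `uex`. -/
def v (P : Instance dx ds dy du dη) (uex : ℕ → Vec du) (t : ℕ) : VecYU dy du :=
  stack (P.y uex t) (P.u uex t)

/-- The controller signal `η_t` under exogenous inputs `uex`. -/
def η (P : Instance dx ds dy du dη) (uex : ℕ → Vec du) (t : ℕ) : Vec dη :=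
  P.ctrl.Cη *ₑ (P.state uex t).2 + P.ctrl.Dη *ₑ P.y uex t

/-- Nature's `v`: no exogenous input. -/
def vNat (P : Instance dx ds dy du dη) : ℕ → VecYU dy du := P.v 0

/-- Nature's `η`: no exogenous input. -/
def ηNat (P : Instance dx ds dy du dη) : ℕ → Vec dη := P.η 0

/-- State `(x_t, s_t)` when the LDC `π` is executed on the system instead. -/
def ldcState (P : Instance dx ds dy du dη) (π : LDC dy du) : ℕ → Vec dx × Vec π.dim
  | 0 => (0, 0)
  | t + 1 =>
    let x := (ldcState P π t).1
    let s := (ldcState P π t).2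
    let y := P.sys.C *ₑ x + P.e t
    let u := π.C *ₑ s + π.D *ₑ y
    (P.sys.A *ₑ x + P.sys.B *ₑ u + P.w t, π.A *ₑ s + π.B *ₑ y)

/-- `v_t^π = (y_t^π, u_t^π)`. -/
def ldcV (P : Instance dx ds dy du dη) (π : LDC dy du) (t : ℕ) : VecYU dy du :=
  let y := P.sys.C *ₑ (P.ldcState π t).1 + P.e t
  stack y (π.C *ₑ (P.ldcState π t).2 + π.D *ₑ y)

end Instance

/-! ### Markov operators -/

/-- The norm `‖G‖_{ℓ₁,op} = ∑ ‖G^[i]‖`; it is only used together with summability. -/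
def l1op {ι κ : Type} [Fintype ι] [Fintype κ] [DecidableEq κ] (G : ℕ → Matrix ι κ ℝ) : ℝ :=
  ∑' i, ‖G i‖

/-- The decay function `ψ_G(n) = ∑_{i ≥ n} ‖G^[i]‖`; it is only used together with summability. -/
def decay {ι κ : Type} [Fintype ι] [Fintype κ] [DecidableEq κ] (G : ℕ → Matrix ι κ ℝ) (n : ℕ) :
    ℝ :=
  ∑' i, ‖G (n + i)‖

/-- Proper, stable decay functions (finiteness of `ψ 0` is automatic for real values). -/
def IsDecayFunction (ψ : ℕ → ℝ) : Prop := (∀ n, 0 ≤ ψ n) ∧ Antitone ψ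

namespace Instance

/-- State matrix of the closed loop with the nominal controller, on `(x, s)`. -/
def Acl (P : Instance dx ds dy du dη) : Matrix (Fin dx ⊕ Fin ds) (Fin dx ⊕ Fin ds) ℝ :=
  Matrix.fromBlocks (P.sys.A + P.sys.B * P.ctrl.D * P.sys.C) (P.sys.B * P.ctrl.C)
    (P.ctrl.B * P.sys.C) P.ctrl.A

/-- Input matrix of the closed loop, from `uᵉˣ` to `(x, s)`. -/
def Bcl (P : Instance dx ds dy du dη) : Matrix (Fin dx ⊕ Fin ds) (Fin du) ℝ :=
  Matrix.fromRows P.sys.B P.ctrl.Bu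

/-- The Markov operator `G_{ex → v}` from exogenous inputs to `v = (y, u)`. -/
def Gv (P : Instance dx ds dy du dη) : ℕ → Matrix (Fin dy ⊕ Fin du) (Fin du) ℝ
  | 0 => Matrix.fromRows 0 1
  | i + 1 => Matrix.fromBlocks P.sys.C 0 (P.ctrl.D * P.sys.C) P.ctrl.C * P.Acl ^ i * P.Bcl

/-- The Markov operator `G_{ex → η}` from exogenous inputs to `η`. -/
def Gη (P : Instance dx ds dy du dη) : ℕ → Matrix (Fin dη) (Fin du) ℝ
  | 0 => 0
  | i + 1 => Matrix.fromCols (P.ctrl.Dη * P.sys.C) P.ctrl.Cη * P.Acl ^ i * P.Bcl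

/-- `Gc` is a conversion operator `π₀ → π`: with the inputs `∑_{j ≤ i} Gc^[i-j] η^nat_j`, the
nominal closed loop reproduces the sequence `(y^π, u^π)`. -/
def IsConversion (P : Instance dx ds dy du dη) (π : LDC dy du)
    (Gc : ℕ → Matrix (Fin du) (Fin dη) ℝ) : Prop :=
  ∀ t, P.ldcV π t = P.vNat t + ∑ i ∈ Finset.range (t + 1),
    P.Gv (t - i) *ₑ (∑ j ∈ Finset.range (i + 1), Gc (i - j) *ₑ P.ηNat j)

/-- The benchmark class `Π_{stab,π₀}(R, ψ)`. -/
def policyClass (P : Instance dx ds dy du dη) (R : ℝ) (ψ : ℕ → ℝ) : Set (LDC dy du) :=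
  {π | ∃ Gc : ℕ → Matrix (Fin du) (Fin dη) ℝ, P.IsConversion π Gc ∧
    Summable (fun i => ‖Gc i‖) ∧ l1op Gc ≤ R ∧ ∀ n, decay Gc n ≤ ψ n}

end Instance

/-! ### Disturbance response controllers -/

/-- The input `uᵉˣ_t(M | η) = ∑_{i < m} M^[i] η_{t-i}`, where `η` vanishes before the start. -/
def drcInput {m : ℕ} (M : Fin m → Matrix (Fin du) (Fin dη) ℝ) (η : ℕ → Vec dη) (t : ℕ) : Vec du :=
  ∑ i : Fin m, if (i : ℕ) ≤ t then M i *ₑ η (t - i) else 0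

/-- The controller class `M_drc(m, R)`. -/
def drcClass (du dη m : ℕ) (R : ℝ) : Set (Fin m → Matrix (Fin du) (Fin dη) ℝ) :=
  {M | ∑ i, ‖M i‖ ≤ R}

/-- The space of vectorized controller parameters. -/
abbrev ParamVec (m du dη : ℕ) : Type := EuclideanSpace ℝ (Fin m × Fin du × Fin dη)

/-- The vectorization `𝔢(M)` of a controller parameter. -/
def embed {m : ℕ} (M : Fin m → Matrix (Fin du) (Fin dη) ℝ) : ParamVec m du dη :=
  WithLp.toLp 2 (fun p => M p.1 p.2.1 p.2.2)

/-- The matrix `𝐘_t` built from `η`, for which `𝐘_t 𝔢(M) = uᵉˣ_t(M | η)`. -/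
def embedY (m du : ℕ) {dη : ℕ} (η : ℕ → Vec dη) (t : ℕ) :
    Matrix (Fin du) (Fin m × Fin du × Fin dη) ℝ :=
  fun a p => if a = p.2.1 ∧ (p.1 : ℕ) ≤ t then η (t - p.1) p.2.2 else 0

theorem embedY_act_embed {m : ℕ} (M : Fin m → Matrix (Fin du) (Fin dη) ℝ) (η : ℕ → Vec dη)
    (t : ℕ) : embedY m du η t *ₑ embed M = drcInput M η t := by
  ext a
  simp only [act, embed, embedY, drcInput, Matrix.mulVec, dotProduct, Fintype.sum_prod_type]
  rw [WithLp.ofLp_sum, Finset.sum_apply]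
  refine Finset.sum_congr rfl fun i _ => ?_
  by_cases hi : (i : ℕ) ≤ t
  · simp [hi, Matrix.mulVec, dotProduct, mul_comm]
  · simp [hi]

namespace Instance

/-- The algorithm's reconstruction `η̂^nat_t = η_t - ∑_{j < t} Ĝ^[t-j] uᵉˣ_j` of nature's `η`. -/
def ηHat (P : Instance dx ds dy du dη) (Ghat : ℕ → Matrix (Fin dη) (Fin du) ℝ)
    (uex : ℕ → Vec du) (t : ℕ) : Vec dη :=
  P.η uex t - ∑ j ∈ Finset.range t, Ghat (t - j) *ₑ uex j

/-- The first `k` exogenous inputs of the algorithm (continued by zero). During the `N`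
exploration rounds the input is `ξ t`; afterwards it is `uᵉˣ_t(M_t | η̂^nat)`, with `η̂^nat`
reconstructed from the signals and inputs seen so far and the estimate `Ghat`. -/
def algPrefix (P : Instance dx ds dy du dη) {m : ℕ} (N : ℕ) (ξ : ℕ → Vec du)
    (Ghat : ℕ → Matrix (Fin dη) (Fin du) ℝ) (M : ℕ → Fin m → Matrix (Fin du) (Fin dη) ℝ) :
    ℕ → ℕ → Vec du
  | 0 => 0
  | t + 1 => Function.update (algPrefix P N ξ Ghat M t) t
      (if t < N then ξ t else drcInput (M t) (P.ηHat Ghat (algPrefix P N ξ Ghat M t)) t)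

/-- The exogenous inputs of the estimate-then-control algorithm with exploration inputs `ξ`,
estimate `Ghat` of `G_{ex → η}` and controller iterates `M_t`. -/
def algInput (P : Instance dx ds dy du dη) {m : ℕ} (N : ℕ) (ξ : ℕ → Vec du)
    (Ghat : ℕ → Matrix (Fin dη) (Fin du) ℝ) (M : ℕ → Fin m → Matrix (Fin du) (Fin dη) ℝ)
    (t : ℕ) : Vec du :=
  P.algPrefix N ξ Ghat M (t + 1) t

/-! ### Regret -/

/-- `ControlReg_T` of exogenous inputs `uex` against a nonempty policy class. -/
def controlRegret (P : Instance dx ds dy du dη) (T : ℕ) (uex : ℕ → Vec du)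
    (Pi : Set (LDC dy du)) : ℝ :=
  ∑ t ∈ Finset.range T, P.loss t (P.v uex t)
    - sInf ((fun π => ∑ t ∈ Finset.range T, P.loss t (P.ldcV π t)) '' Pi)

/-- The loss with memory
`F_t(z_{t:t-h} | η) = ℓ_t(v^nat_t + ∑_{i ≤ h} G_{ex → v}^[i] 𝐘_{t-i} z_{t-i})`, where `𝐘_s` is
built from `η` (and vanishes before the start). -/
def memLoss (P : Instance dx ds dy du dη) {m : ℕ} (h : ℕ) (η : ℕ → Vec dη) (t : ℕ)
    (z : ℕ → ParamVec m du dη) : ℝ :=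
  P.loss t (P.vNat t + ∑ i ∈ Finset.range (h + 1),
    if i ≤ t then P.Gv i *ₑ (embedY m du η (t - i) *ₑ z (t - i)) else 0)

/-- Memory regret on the indices `a ≤ t < T` against the fixed parameter `zstar`:
`∑ F_t(z_{t:t-h} | η) - ∑ f_t(zstar | η)`, where `f_t(z | η) = F_t(z, …, z | η)`. -/
def memoryRegret (P : Instance dx ds dy du dη) {m : ℕ} (h a T : ℕ) (η : ℕ → Vec dη)
    (z : ℕ → ParamVec m du dη) (zstar : ParamVec m du dη) : ℝ :=
  ∑ t ∈ Finset.Ico a T, P.memLoss h η t z - ∑ t ∈ Finset.Ico a T, P.memLoss h η t (fun _ => zstar)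

end Instance

/-! ### Assumptions -/

/-- Convex, differentiable, nonnegative, `L`-subquadratic losses. -/
structure IsRegularLoss (L : ℝ) (ℓ : VecYU dy du → ℝ) : Prop where
  convex : ConvexOn ℝ Set.univ ℓ
  differentiable : Differentiable ℝ ℓ
  nonneg : ∀ v, 0 ≤ ℓ v
  le : ∀ v, ℓ v ≤ L * max 1 (‖v‖ ^ 2)
  grad_le : ∀ v, ‖gradient ℓ v‖ ≤ L * max 1 ‖v‖

/-- The Markov operator `G` is stable, with norm at most `R` and decay function at most `ψ`. -/
structure IsStableOperator {ι κ : Type} [Fintype ι] [Fintype κ] [DecidableEq κ]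
    (G : ℕ → Matrix ι κ ℝ) (R : ℝ) (ψ : ℕ → ℝ) : Prop where
  summable : Summable (fun i => ‖G i‖)
  norm_le : l1op G ≤ R
  decay_le : ∀ n, decay G n ≤ ψ n

/-- The parameters of the algorithm and of the assumptions. -/
structure Params where
  /-- horizon -/
  T : ℕ
  /-- number of exploration rounds -/
  N : ℕ
  /-- memory length -/
  h : ℕ
  /-- controller length of the algorithm -/
  m : ℕ
  /-- controller length of the comparator -/
  mstar : ℕ
  L : ℝ
  /-- bound on the Markov operators of the nominal closed loop -/
  R0 : ℝ
  /-- bound on nature's iterates -/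
  Rnat : ℝ
  /-- controller radius of the algorithm -/
  RM : ℝ
  /-- controller radius of the comparator -/
  Rstar : ℝ
  /-- slack -/
  c : ℝ
  /-- failure probability -/
  δ : ℝ
  /-- estimation error -/
  ε : ℝ
  ψ0 : ℕ → ℝ
  ψstar : ℕ → ℝ

/-- The bound `R_{u,est} = 3 √(d_u + log (1/δ))` on the exploration inputs. -/
def Params.Ruest (p : Params) (du : ℕ) : ℝ := 3 * √(du + Real.log (1 / p.δ))

/-- Relations among the parameters. -/
structure Params.Admissible (p : Params) : Prop where
  one_le_T : 1 ≤ p.T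
  one_le_m : 1 ≤ p.m
  one_le_Rnat : 1 ≤ p.Rnat
  one_le_RM : 1 ≤ p.RM
  one_le_c : 1 ≤ p.c
  δ_pos : 0 < p.δ
  δ_lt_one : p.δ < 1
  decay_ψ0 : IsDecayFunction p.ψ0
  decay_ψstar : IsDecayFunction p.ψstar
  two_Rstar_le_RM : 2 * p.Rstar ≤ p.RM
  m_ge : 2 * p.mstar + p.h ≤ p.m
  N_ge : p.m + p.h ≤ p.N
  ψ0_le : p.ψ0 (p.h + 1) ≤ p.c * p.R0 / p.T
  ψstar_le : p.ψstar p.mstar ≤ p.c * p.Rstar / p.T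

/-- Regular losses, a stable nominal closed loop, and bounded nature's iterates. -/
structure Instance.Regular (P : Instance dx ds dy du dη) (p : Params) : Prop where
  loss : ∀ t, IsRegularLoss p.L (P.loss t)
  Gv : IsStableOperator P.Gv p.R0 p.ψ0
  Gη : IsStableOperator P.Gη p.R0 p.ψ0
  vNat_le : ∀ t, ‖P.vNat t‖ ≤ p.Rnat
  ηNat_le : ∀ t, ‖P.ηNat t‖ ≤ p.Rnat

/-- `Ghat` is within `ε` of `G` in `ℓ₁,op`-norm. Beyond lag `h` it is truncated, as for an
estimate of the first `h` Markov parameters (or exact, which admits `Ghat = G`). -/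
structure IsMarkovEstimate {ι κ : Type} [Fintype ι] [Fintype κ] [DecidableEq κ] (h : ℕ) (ε : ℝ)
    (G Ghat : ℕ → Matrix ι κ ℝ) : Prop where
  tail : ∀ i, h < i → Ghat i = 0 ∨ Ghat i = G i
  summable : Summable (fun i => ‖Ghat i - G i‖)
  error_le : l1op (fun i => Ghat i - G i) ≤ ε

/-- The part of the estimation event that concerns the accuracy level and the exploration
inputs. -/
structure GoodExploration (p : Params) (ξ : ℕ → Vec du) : Prop where
  ε_le : p.ε ≤ 1 / max (p.Ruest du) (2 * p.RM * p.R0)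
  input_le : ∀ t < p.N, ‖ξ t‖ ≤ p.Ruest du

end NonstochasticControl

end

/-!
All signals are convolutions of Markov operators with input sequences. Writing `G` for
`G_{ex → v}`, `Gc` for the conversion operator of a policy and `D` for the error of the estimate of
`G_{ex → η}`, the policy produces `vⁿᵃᵗ + G ⋆ Gc ⋆ ηⁿᵃᵗ`, and the algorithm sees
`η̂ = ηⁿᵃᵗ - D ⋆ u`. Hence the policy plays the inputs `Gc ⋆ (η̂ + D ⋆ u)`, which depend on the
inputs `u` of the algorithm. Replacing `u` by the inputs `w` of the comparator itself and keeping
the first two terms of the resulting Neumann series yields a comparator `Gc + Gc ⋆ D ⋆ Gc` that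
reproduces the policy up to `O(ε²)` and a term of order `ε ‖u - w‖`; the latter is paid for by the
term with `ν`.

Gradients of the losses can be large at the iterates of the policy, and only `vⁿᵃᵗ` is bounded a
priori. The comparator is therefore shrunk by a factor `1 - α`: by convexity,
`ℓ (v₀ + (1 - α) (V - v₀) + d) ≤ ℓ V + O(L) (α Rnat² + ‖d‖² / α)`. Summing over time and balancing
gives `α² S = Q α`, where `Q` depends on `α` because the comparator does; the intermediate value
theorem solves this equation. This choice of `α`, and with it of `z⋆`, does not depend on `ν`.
-/

noncomputable section

namespace NonstochasticControl

open Finset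

variable {dx ds dy du dη : ℕ}

section Act

variable {ι κ l : Type} [Fintype ι] [Fintype κ] [Fintype l]

/-- The product `A *ₑ x` as a bilinear map. -/
def actₗ : Matrix ι κ ℝ →ₗ[ℝ] EuclideanSpace ℝ κ →ₗ[ℝ] EuclideanSpace ℝ ι :=
  LinearMap.mk₂ ℝ act (fun A B x => by simp [act, Matrix.add_mulVec])
    (fun r A x => by simp [act, Matrix.smul_mulVec])
    (fun A x y => by simp [act, Matrix.mulVec_add])
    (fun r A x => by simp [act, Matrix.mulVec_smul])

theorem act_add (A : Matrix ι κ ℝ) (x y : EuclideanSpace ℝ κ) :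
    A *ₑ (x + y) = A *ₑ x + A *ₑ y :=
  map_add (actₗ A) x y

theorem act_sub (A : Matrix ι κ ℝ) (x y : EuclideanSpace ℝ κ) :
    A *ₑ (x - y) = A *ₑ x - A *ₑ y :=
  map_sub (actₗ A) x y

theorem act_smul (A : Matrix ι κ ℝ) (r : ℝ) (x : EuclideanSpace ℝ κ) :
    A *ₑ (r • x) = r • (A *ₑ x) :=
  map_smul (actₗ A) r x

theorem act_zero (A : Matrix ι κ ℝ) : A *ₑ (0 : EuclideanSpace ℝ κ) = 0 :=
  map_zero (actₗ A)

theorem act_sum {α : Type*} (s : Finset α) (A : Matrix ι κ ℝ) (f : α → EuclideanSpace ℝ κ) :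
    A *ₑ (∑ i ∈ s, f i) = ∑ i ∈ s, A *ₑ f i :=
  map_sum (actₗ A) f s

theorem add_act (A B : Matrix ι κ ℝ) (x : EuclideanSpace ℝ κ) :
    (A + B) *ₑ x = A *ₑ x + B *ₑ x :=
  LinearMap.map_add₂ actₗ A B x

theorem smul_act (r : ℝ) (A : Matrix ι κ ℝ) (x : EuclideanSpace ℝ κ) :
    (r • A) *ₑ x = r • (A *ₑ x) :=
  LinearMap.map_smul₂ actₗ r A x

theorem zero_act (x : EuclideanSpace ℝ κ) : (0 : Matrix ι κ ℝ) *ₑ x = 0 :=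
  LinearMap.map_zero₂ actₗ x

theorem sum_act {α : Type*} (s : Finset α) (f : α → Matrix ι κ ℝ) (x : EuclideanSpace ℝ κ) :
    (∑ i ∈ s, f i) *ₑ x = ∑ i ∈ s, f i *ₑ x :=
  LinearMap.map_sum₂ actₗ s f x

theorem one_act [DecidableEq κ] (x : EuclideanSpace ℝ κ) : (1 : Matrix κ κ ℝ) *ₑ x = x := by
  simp [act]

theorem mul_act (A : Matrix ι κ ℝ) (B : Matrix κ l ℝ) (x : EuclideanSpace ℝ l) :
    (A * B) *ₑ x = A *ₑ B *ₑ x := by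
  simp [act, Matrix.mulVec_mulVec]

theorem norm_act_le [DecidableEq κ] (A : Matrix ι κ ℝ) (x : EuclideanSpace ℝ κ) :
    ‖A *ₑ x‖ ≤ ‖A‖ * ‖x‖ :=
  Matrix.l2_opNorm_mulVec A x

theorem norm_le_of_norm_act_le [DecidableEq κ] {A : Matrix ι κ ℝ} {c : ℝ} (hc : 0 ≤ c)
    (h : ∀ x, ‖A *ₑ x‖ ≤ c * ‖x‖) : ‖A‖ ≤ c := by
  rw [Matrix.l2_opNorm_def]
  exact ContinuousLinearMap.opNorm_le_bound _ hc h

end Act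

/-! ### Convolution with Markov operators -/

section Truncation

variable {E : Type*}

/-- The truncation of a sequence, in particular of a Markov operator, to the lags less than `n`. -/
def trunc [Zero E] (n : ℕ) (G : ℕ → E) : ℕ → E := (Set.Iio n).indicator G

/-- The part of a sequence, in particular of a Markov operator, of lag at least `n`. -/
def tail [Zero E] (n : ℕ) (G : ℕ → E) : ℕ → E := (Set.Ici n).indicator G

theorem trunc_add_tail [AddZeroClass E] (n : ℕ) (G : ℕ → E) : trunc n G + tail n G = G := by
  rw [trunc, tail, ← Set.compl_Iio, Set.indicator_self_add_compl]

variable [Zero E] {n i : ℕ}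

theorem trunc_of_lt (h : i < n) (G : ℕ → E) : trunc n G i = G i :=
  Set.indicator_of_mem (Set.mem_Iio.2 h) G

theorem trunc_of_le (h : n ≤ i) (G : ℕ → E) : trunc n G i = 0 :=
  Set.indicator_of_notMem (Set.notMem_Iio.2 h) G

theorem tail_of_lt (h : i < n) (G : ℕ → E) : tail n G i = 0 :=
  Set.indicator_of_notMem (Set.notMem_Ici.2 h) G

theorem tail_of_le (h : n ≤ i) (G : ℕ → E) : tail n G i = G i :=
  Set.indicator_of_mem (Set.mem_Ici.2 h) G

end Truncation

section Conv

variable {ι κ l : Type} [Fintype κ]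

/-- The composition `t ↦ ∑_{i + j = t} G^[i] H^[j]` of two Markov operators. -/
def mconv (G : ℕ → Matrix ι κ ℝ) (H : ℕ → Matrix κ l ℝ) (t : ℕ) : Matrix ι l ℝ :=
  ∑ p ∈ antidiagonal t, G p.1 * H p.2

theorem mconv_eq_zero {G : ℕ → Matrix ι κ ℝ} {H : ℕ → Matrix κ l ℝ} {a b n : ℕ}
    (hG : ∀ i, a ≤ i → G i = 0) (hH : ∀ i, b ≤ i → H i = 0) (hn : a + b ≤ n + 1) :
    mconv G H n = 0 := by
  refine sum_eq_zero fun p hp => ?_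
  rw [HasAntidiagonal.mem_antidiagonal] at hp
  rcases le_or_gt a p.1 with h | h
  · rw [hG _ h, Matrix.zero_mul]
  · rw [hH p.2 (by omega), Matrix.mul_zero]

variable [Fintype ι] [Fintype l]

/-- The response `t ↦ ∑_{i + j = t} G^[i] x_j` of a Markov operator `G` to an input sequence `x`,
as a bilinear map. -/
def conv : (ℕ → Matrix ι κ ℝ) →ₗ[ℝ] (ℕ → EuclideanSpace ℝ κ) →ₗ[ℝ] (ℕ → EuclideanSpace ℝ ι) :=
  LinearMap.mk₂ ℝ (fun G x t => ∑ p ∈ antidiagonal t, G p.1 *ₑ x p.2)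
    (fun G H x => by ext1 t; simp [add_act, sum_add_distrib])
    (fun r G x => by ext1 t; simp [smul_act, smul_sum])
    (fun G x y => by ext1 t; simp [act_add, sum_add_distrib])
    (fun r G x => by ext1 t; simp [act_smul, smul_sum])

infixr:73 " ⋆ " => conv

theorem conv_apply (G : ℕ → Matrix ι κ ℝ) (x : ℕ → EuclideanSpace ℝ κ) (t : ℕ) :
    (G ⋆ x) t = ∑ p ∈ antidiagonal t, G p.1 *ₑ x p.2 :=
  rfl

theorem conv_eq_sum_range (G : ℕ → Matrix ι κ ℝ) (x : ℕ → EuclideanSpace ℝ κ) (t : ℕ) :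
    (G ⋆ x) t = ∑ i ∈ range (t + 1), G i *ₑ x (t - i) :=
  Nat.sum_antidiagonal_eq_sum_range_succ (fun i j => G i *ₑ x j) t

theorem conv_eq_sum_range_flip (G : ℕ → Matrix ι κ ℝ) (x : ℕ → EuclideanSpace ℝ κ) (t : ℕ) :
    (G ⋆ x) t = ∑ j ∈ range (t + 1), G (t - j) *ₑ x j := by
  rw [conv_apply, ← Nat.sum_antidiagonal_swap]
  exact Nat.sum_antidiagonal_eq_sum_range_succ (fun j i => G i *ₑ x j) t

theorem conv_conv (G : ℕ → Matrix ι κ ℝ) (H : ℕ → Matrix κ l ℝ) (x : ℕ → EuclideanSpace ℝ l) :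
    G ⋆ H ⋆ x = mconv G H ⋆ x := by
  funext t
  simp only [conv_apply, mconv, act_sum, sum_act, mul_act, sum_sigma']
  refine sum_nbij' (fun p => ⟨(p.1.1 + p.2.1, p.2.2), (p.1.1, p.2.1)⟩)
    (fun p => ⟨(p.2.1, p.2.2 + p.1.2), (p.2.2, p.1.2)⟩) ?_ ?_ ?_ ?_ ?_ <;>
    rintro ⟨⟨a, b⟩, ⟨c, d⟩⟩ <;>
    simp only [mem_sigma, HasAntidiagonal.mem_antidiagonal] <;> grind

theorem conv_trunc (n : ℕ) (G : ℕ → Matrix ι κ ℝ) (x : ℕ → EuclideanSpace ℝ κ) (t : ℕ) :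
    (trunc n G ⋆ x) t = ∑ i ∈ range n, if i ≤ t then G i *ₑ x (t - i) else 0 := by
  calc (trunc n G ⋆ x) t
      = ∑ i ∈ range (t + 1), if i < n then G i *ₑ x (t - i) else 0 := by
        rw [conv_eq_sum_range]
        refine sum_congr rfl fun i _ => ?_
        split_ifs with hi
        · rw [trunc_of_lt hi]
        · rw [trunc_of_le (not_lt.1 hi), zero_act]
    _ = ∑ i ∈ range n, if i ≤ t then G i *ₑ x (t - i) else 0 := by
        rw [← sum_filter, ← sum_filter]
        refine sum_congr ?_ fun _ _ => rfl
        ext i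
        simp only [mem_filter, mem_range]
        omega

/-- The bound `‖G‖_{ℓ₁,op} ≤ g`, stated through the partial sums so that it carries
summability. -/
def L1opLE [DecidableEq κ] (G : ℕ → Matrix ι κ ℝ) (g : ℝ) : Prop :=
  ∀ T, ∑ i ∈ range T, ‖G i‖ ≤ g

variable [DecidableEq κ]

theorem sum_range_sum_antidiagonal_le {a b : ℕ → ℝ} (ha : ∀ i, 0 ≤ a i) (hb : ∀ i, 0 ≤ b i)
    (T : ℕ) : ∑ t ∈ range T, ∑ p ∈ antidiagonal t, a p.1 * b p.2 ≤
      (∑ i ∈ range T, a i) * ∑ j ∈ range T, b j := by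
  calc ∑ t ∈ range T, ∑ p ∈ antidiagonal t, a p.1 * b p.2
      = ∑ i ∈ range T, ∑ j ∈ range (T - i), a i * b j := by
        rw [← sum_range_diag_flip]
        exact sum_congr rfl fun t _ =>
          Nat.sum_antidiagonal_eq_sum_range_succ (fun i j => a i * b j) t
    _ ≤ ∑ i ∈ range T, ∑ j ∈ range T, a i * b j :=
        sum_le_sum fun i _ => sum_le_sum_of_subset_of_nonneg (range_mono (Nat.sub_le T i))
          fun j _ _ => mul_nonneg (ha i) (hb j)
    _ = (∑ i ∈ range T, a i) * ∑ j ∈ range T, b j := (sum_mul_sum ..).symm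

namespace L1opLE

variable {G H : ℕ → Matrix ι κ ℝ} {g g' : ℝ}

theorem nonneg (h : L1opLE G g) : 0 ≤ g := by
  simpa using h 0

theorem mono (h : L1opLE G g) (hH : ∀ i, ‖H i‖ ≤ ‖G i‖) : L1opLE H g :=
  fun T => (sum_le_sum fun i _ => hH i).trans (h T)

theorem of_l1op_le (hs : Summable fun i => ‖G i‖) (h : l1op G ≤ g) : L1opLE G g :=
  fun _ => (hs.sum_le_tsum _ fun _ _ => norm_nonneg _).trans h

theorem add (h : L1opLE G g) (h' : L1opLE H g') : L1opLE (G + H) (g + g') := fun T =>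
  calc ∑ i ∈ range T, ‖G i + H i‖ ≤ ∑ i ∈ range T, (‖G i‖ + ‖H i‖) :=
        sum_le_sum fun _ _ => norm_add_le _ _
    _ ≤ g + g' := by rw [sum_add_distrib]; exact add_le_add (h T) (h' T)

theorem smul (h : L1opLE G g) {r : ℝ} (hr : 0 ≤ r) : L1opLE (r • G) (r * g) := fun T => by
  simp only [Pi.smul_apply, norm_smul, ← mul_sum, Real.norm_of_nonneg hr]
  exact mul_le_mul_of_nonneg_left (h T) hr

theorem mconv [DecidableEq l] {H : ℕ → Matrix κ l ℝ} (h : L1opLE G g) (h' : L1opLE H g') :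
    L1opLE (mconv G H) (g * g') := fun T =>
  calc ∑ t ∈ range T, ‖∑ p ∈ antidiagonal t, G p.1 * H p.2‖
      ≤ ∑ t ∈ range T, ∑ p ∈ antidiagonal t, ‖G p.1‖ * ‖H p.2‖ :=
        sum_le_sum fun _ _ => norm_sum_le_of_le _ fun _ _ => Matrix.l2_opNorm_mul _ _
    _ ≤ (∑ i ∈ range T, ‖G i‖) * ∑ j ∈ range T, ‖H j‖ :=
        sum_range_sum_antidiagonal_le (fun _ => norm_nonneg _) (fun _ => norm_nonneg _) T
    _ ≤ g * g' := mul_le_mul (h T) (h' T) (sum_nonneg fun _ _ => norm_nonneg _) h.nonneg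

theorem trunc (h : L1opLE G g) (n : ℕ) : L1opLE (trunc n G) g :=
  h.mono fun i => norm_indicator_le_norm_self G i

theorem tail (h : L1opLE G g) (n : ℕ) : L1opLE (tail n G) g :=
  h.mono fun i => norm_indicator_le_norm_self G i

theorem tail_of_decay_le {n : ℕ} (hs : Summable fun i => ‖G i‖) (h : decay G n ≤ g) :
    L1opLE (NonstochasticControl.tail n G) g := fun T => by
  have hs' : Summable fun i => ‖G (n + i)‖ := by
    simpa only [add_comm] using (summable_nat_add_iff n).2 hs
  calc ∑ i ∈ range T, ‖NonstochasticControl.tail n G i‖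
      ≤ ∑ i ∈ range (n + T), ‖NonstochasticControl.tail n G i‖ :=
        sum_le_sum_of_subset_of_nonneg (range_mono (by omega)) fun _ _ _ => norm_nonneg _
    _ = ∑ i ∈ range T, ‖G (n + i)‖ := by
        rw [sum_range_add, sum_eq_zero fun i hi => by rw [tail_of_lt (mem_range.1 hi), norm_zero],
          zero_add]
        exact sum_congr rfl fun i _ => by rw [tail_of_le (Nat.le_add_right n i)]
    _ ≤ g := (hs'.sum_le_tsum (range T) fun i _ => norm_nonneg _).trans h

theorem norm_conv_le (h : L1opLE G g) {x : ℕ → EuclideanSpace ℝ κ} {B : ℝ} (hx : ∀ j, ‖x j‖ ≤ B)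
    (t : ℕ) : ‖(G ⋆ x) t‖ ≤ g * B := by
  rw [conv_eq_sum_range]
  calc ‖∑ i ∈ range (t + 1), G i *ₑ x (t - i)‖ ≤ ∑ i ∈ range (t + 1), ‖G i‖ * B :=
        norm_sum_le_of_le _ fun i _ => (norm_act_le _ _).trans <| by gcongr; exact hx _
    _ ≤ g * B := by
        rw [← sum_mul]
        exact mul_le_mul_of_nonneg_right (h _) ((norm_nonneg _).trans (hx 0))

theorem norm_conv_sq_le (h : L1opLE G g) (x : ℕ → EuclideanSpace ℝ κ) (t : ℕ) :
    ‖(G ⋆ x) t‖ ^ 2 ≤ g * ∑ p ∈ antidiagonal t, ‖G p.1‖ * ‖x p.2‖ ^ 2 := by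
  have hG : ∑ p ∈ antidiagonal t, ‖G p.1‖ ≤ g :=
    (Nat.sum_antidiagonal_eq_sum_range_succ (fun i _ => ‖G i‖) t).trans_le (h _)
  calc ‖(G ⋆ x) t‖ ^ 2 ≤ (∑ p ∈ antidiagonal t, ‖G p.1‖ * ‖x p.2‖) ^ 2 := by
        rw [conv_apply]
        exact pow_le_pow_left₀ (norm_nonneg _)
          (norm_sum_le_of_le _ fun p _ => norm_act_le (G p.1) (x p.2)) 2
    _ ≤ (∑ p ∈ antidiagonal t, ‖G p.1‖) * ∑ p ∈ antidiagonal t, ‖G p.1‖ * ‖x p.2‖ ^ 2 :=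
        sum_sq_le_sum_mul_sum_of_sq_le_mul _ (fun _ _ => norm_nonneg _)
          (fun _ _ => by positivity) fun _ _ => le_of_eq (by ring)
    _ ≤ g * ∑ p ∈ antidiagonal t, ‖G p.1‖ * ‖x p.2‖ ^ 2 := by gcongr

theorem sum_norm_conv_sq_le (h : L1opLE G g) (x : ℕ → EuclideanSpace ℝ κ) (T : ℕ) :
    ∑ t ∈ range T, ‖(G ⋆ x) t‖ ^ 2 ≤ g ^ 2 * ∑ t ∈ range T, ‖x t‖ ^ 2 := by
  have hg : 0 ≤ g := h.nonneg
  calc ∑ t ∈ range T, ‖(G ⋆ x) t‖ ^ 2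
      ≤ g * ∑ t ∈ range T, ∑ p ∈ antidiagonal t, ‖G p.1‖ * ‖x p.2‖ ^ 2 := by
        rw [mul_sum]
        exact sum_le_sum fun t _ => h.norm_conv_sq_le x t
    _ ≤ g * ((∑ i ∈ range T, ‖G i‖) * ∑ t ∈ range T, ‖x t‖ ^ 2) := by
        gcongr
        exact sum_range_sum_antidiagonal_le (fun i => norm_nonneg (G i))
          (fun j => sq_nonneg ‖x j‖) T
    _ ≤ g * (g * ∑ t ∈ range T, ‖x t‖ ^ 2) := by gcongr; exact h T
    _ = g ^ 2 * ∑ t ∈ range T, ‖x t‖ ^ 2 := by ring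

end L1opLE

end Conv

/-! ### The closed loop with the nominal controller -/

section MarkovOperator

variable {ι κ l : Type} [Fintype ι] [DecidableEq ι] [Fintype κ] [Fintype l]
  {A : Matrix ι ι ℝ} {B : Matrix ι κ ℝ} {x : ℕ → EuclideanSpace ℝ ι} {u : ℕ → EuclideanSpace ℝ κ}

/-- The Markov operator of the linear system `x_{t+1} = A x_t + B u_t`, `y_t = C x_t + D u_t`. -/
def markovOperator (A : Matrix ι ι ℝ) (B : Matrix ι κ ℝ) (C : Matrix l ι ℝ) (D : Matrix l κ ℝ) :
    ℕ → Matrix l κ ℝ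
  | 0 => D
  | i + 1 => C * A ^ i * B

theorem state_succ_eq_sum_antidiagonal (h0 : x 0 = 0) (hx : ∀ t, x (t + 1) = A *ₑ x t + B *ₑ u t)
    (t : ℕ) : x (t + 1) = ∑ p ∈ antidiagonal t, A ^ p.1 *ₑ B *ₑ u p.2 := by
  induction t with
  | zero => simp [hx, h0, act_zero, one_act]
  | succ t ih =>
    rw [Nat.sum_antidiagonal_succ, hx (t + 1), ih, act_sum, add_comm]
    simp only [pow_zero, one_act, pow_succ', mul_act]

theorem markovOperator_conv (h0 : x 0 = 0) (hx : ∀ t, x (t + 1) = A *ₑ x t + B *ₑ u t)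
    (C : Matrix l ι ℝ) (D : Matrix l κ ℝ) (t : ℕ) :
    (markovOperator A B C D ⋆ u) t = C *ₑ x t + D *ₑ u t := by
  cases t with
  | zero => simp [conv_apply, markovOperator, h0, act_zero]
  | succ t =>
    rw [conv_apply, Nat.sum_antidiagonal_succ, state_succ_eq_sum_antidiagonal h0 hx, act_sum,
      add_comm]
    simp only [markovOperator, mul_act]

end MarkovOperator

section Stack

variable {a b : ℕ}

theorem stack_add (x x' : Vec a) (y y' : Vec b) :
    stack (x + x') (y + y') = stack x y + stack x' y' := by
  ext i
  cases i <;> rfl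

theorem fromRows_act {κ : Type} [Fintype κ] (A : Matrix (Fin a) κ ℝ) (B : Matrix (Fin b) κ ℝ)
    (x : EuclideanSpace ℝ κ) : Matrix.fromRows A B *ₑ x = stack (A *ₑ x) (B *ₑ x) := by
  ext i
  cases i <;> rfl

theorem fromCols_act {l : Type} [Fintype l] (A : Matrix l (Fin a) ℝ) (B : Matrix l (Fin b) ℝ)
    (x : Vec a) (y : Vec b) : Matrix.fromCols A B *ₑ stack x y = A *ₑ x + B *ₑ y :=
  congrArg (WithLp.toLp 2) (Matrix.fromCols_mulVec_sumElim A B _ _)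

theorem fromBlocks_act {c d : ℕ} (A : Matrix (Fin c) (Fin a) ℝ) (B : Matrix (Fin c) (Fin b) ℝ)
    (C : Matrix (Fin d) (Fin a) ℝ) (D : Matrix (Fin d) (Fin b) ℝ) (x : Vec a) (y : Vec b) :
    Matrix.fromBlocks A B C D *ₑ stack x y = stack (A *ₑ x + B *ₑ y) (C *ₑ x + D *ₑ y) := by
  rw [← Matrix.fromRows_fromCols_eq_fromBlocks, fromRows_act, fromCols_act, fromCols_act]

end Stack

section ClosedLoop

variable (P : Instance dx ds dy du dη) (uex : ℕ → Vec du) (t : ℕ)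

/-- The state `(x_t, s_t)` of the closed loop as a vector. -/
def closedState : VecYU dx ds :=
  stack (P.state uex t).1 (P.state uex t).2

theorem closedState_succ : closedState P uex (t + 1) =
    P.Acl *ₑ closedState P uex t + P.Bcl *ₑ uex t +
      stack (P.sys.B *ₑ P.ctrl.D *ₑ P.e t + P.w t) (P.ctrl.B *ₑ P.e t) := by
  simp only [closedState, Instance.state, Instance.Acl, Instance.Bcl, fromBlocks_act, fromRows_act,
    ← stack_add, add_act, mul_act, act_add]
  congr 1 <;> abel

theorem v_eq_closedState : P.v uex t =
    Matrix.fromBlocks P.sys.C 0 (P.ctrl.D * P.sys.C) P.ctrl.C *ₑ closedState P uex t +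
      Matrix.fromRows 0 1 *ₑ uex t + stack (P.e t) (P.ctrl.D *ₑ P.e t) := by
  simp only [Instance.v, Instance.u, Instance.y, closedState, fromBlocks_act, fromRows_act,
    ← stack_add, zero_act, one_act, mul_act, act_add]
  congr 1 <;> abel

theorem η_eq_closedState : P.η uex t =
    Matrix.fromCols (P.ctrl.Dη * P.sys.C) P.ctrl.Cη *ₑ closedState P uex t +
      P.ctrl.Dη *ₑ P.e t := by
  simp only [Instance.η, Instance.y, closedState, fromCols_act, mul_act, act_add]
  abel

theorem Gv_eq_markovOperator : P.Gv = markovOperator P.Acl P.Bcl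
    (Matrix.fromBlocks P.sys.C 0 (P.ctrl.D * P.sys.C) P.ctrl.C) (Matrix.fromRows 0 1) := by
  funext i
  cases i <;> rfl

theorem Gη_eq_markovOperator : P.Gη = markovOperator P.Acl P.Bcl
    (Matrix.fromCols (P.ctrl.Dη * P.sys.C) P.ctrl.Cη) 0 := by
  funext i
  cases i <;> rfl

theorem markovOperator_conv_eq_closedState {l : Type} [Fintype l] (C : Matrix l (Fin dx ⊕ Fin ds) ℝ)
    (D : Matrix l (Fin du) ℝ) : (markovOperator P.Acl P.Bcl C D ⋆ uex) t =
      C *ₑ (closedState P uex t - closedState P 0 t) + D *ₑ uex t := by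
  refine markovOperator_conv (x := fun t => closedState P uex t - closedState P 0 t)
    (sub_self _) (fun t => ?_) C D t
  rw [closedState_succ, closedState_succ, act_sub, Pi.zero_apply, act_zero]
  abel

theorem v_eq_vNat_add_conv : P.v uex = P.vNat + P.Gv ⋆ uex := by
  funext t
  rw [Gv_eq_markovOperator, Pi.add_apply, markovOperator_conv_eq_closedState, Instance.vNat,
    v_eq_closedState, v_eq_closedState, act_sub, Pi.zero_apply, act_zero]
  abel

theorem η_eq_ηNat_add_conv : P.η uex = P.ηNat + P.Gη ⋆ uex := by
  funext t
  rw [Gη_eq_markovOperator, Pi.add_apply, markovOperator_conv_eq_closedState, Instance.ηNat,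
    η_eq_closedState, η_eq_closedState, act_sub, zero_act]
  abel

theorem ldcV_eq_vNat_add_conv {P : Instance dx ds dy du dη} {π : LDC dy du}
    {Gc : ℕ → Matrix (Fin du) (Fin dη) ℝ} (h : P.IsConversion π Gc) :
    P.ldcV π = P.vNat + P.Gv ⋆ Gc ⋆ P.ηNat := by
  funext t
  simp only [h t, Pi.add_apply, conv_eq_sum_range_flip]

/-- The error of the estimate `Ghat` of `G_{ex → η}` in lags at least `1`: the reconstruction
`η̂ⁿᵃᵗ_t` does not use the current input, so lag `0` plays no role. -/
def estimationError (P : Instance dx ds dy du dη) (Ghat : ℕ → Matrix (Fin dη) (Fin du) ℝ) :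
    ℕ → Matrix (Fin dη) (Fin du) ℝ :=
  tail 1 (Ghat - P.Gη)

theorem conv_tail_one {ι κ : Type} [Fintype ι] [Fintype κ] (G : ℕ → Matrix ι κ ℝ)
    (x : ℕ → EuclideanSpace ℝ κ) (t : ℕ) :
    (tail 1 G ⋆ x) t = ∑ j ∈ range t, G (t - j) *ₑ x j := by
  rw [conv_eq_sum_range_flip, sum_range_succ, Nat.sub_self, tail_of_lt one_pos, zero_act, add_zero]
  refine sum_congr rfl fun j hj => ?_
  rw [tail_of_le (Nat.sub_pos_of_lt (mem_range.1 hj))]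

theorem tail_one_Gη : tail 1 P.Gη = P.Gη :=
  Set.indicator_eq_self.2 fun i hi => Nat.one_le_iff_ne_zero.2 fun h0 => hi (by rw [h0]; rfl)

theorem ηHat_eq_sub_conv (Ghat : ℕ → Matrix (Fin dη) (Fin du) ℝ) :
    P.ηHat Ghat uex = P.ηNat - estimationError P Ghat ⋆ uex := by
  have h : estimationError P Ghat = tail 1 Ghat - P.Gη := by
    conv_rhs => rw [← tail_one_Gη]
    exact Set.indicator_sub _ _ _
  funext t
  rw [h, map_sub, LinearMap.sub_apply, Pi.sub_apply, Pi.sub_apply, conv_tail_one, Instance.ηHat,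
    η_eq_ηNat_add_conv, Pi.add_apply]
  abel

end ClosedLoop

/-! ### The algorithm -/

section DisturbanceResponse

variable {m : ℕ}

theorem drcInput_eq_trunc_conv (H : ℕ → Matrix (Fin du) (Fin dη) ℝ) (η : ℕ → Vec dη) :
    drcInput (fun i : Fin m => H i) η = trunc m H ⋆ η := by
  funext t
  rw [conv_trunc]
  exact Fin.sum_univ_eq_sum_range (fun i => if i ≤ t then H i *ₑ η (t - i) else 0) m

theorem norm_drcInput_le {M : Fin m → Matrix (Fin du) (Fin dη) ℝ} {R B : ℝ}
    (hM : M ∈ drcClass du dη m R) {η : ℕ → Vec dη} (hη : ∀ s, ‖η s‖ ≤ B) (t : ℕ) :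
    ‖drcInput M η t‖ ≤ R * B := by
  have hB : 0 ≤ B := (norm_nonneg _).trans (hη 0)
  calc ‖drcInput M η t‖ ≤ ∑ i, ‖M i‖ * B := norm_sum_le_of_le _ fun i _ => by
        split_ifs
        · exact (norm_act_le _ _).trans (by gcongr; exact hη _)
        · simpa using mul_nonneg (norm_nonneg (M i)) hB
    _ ≤ R * B := by rw [← sum_mul]; exact mul_le_mul_of_nonneg_right hM hB

theorem memLoss_embed (P : Instance dx ds dy du dη) (h : ℕ) (η : ℕ → Vec dη) (t : ℕ)
    (M : ℕ → Fin m → Matrix (Fin du) (Fin dη) ℝ) :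
    P.memLoss h η t (fun s => embed (M s)) =
      P.loss t (P.vNat t + (trunc (h + 1) P.Gv ⋆ fun s => drcInput (M s) η s) t) := by
  simp only [Instance.memLoss, embedY_act_embed, conv_trunc]

end DisturbanceResponse

section Estimates

variable {ι κ : Type} [Fintype ι] [Fintype κ] [DecidableEq κ] {h : ℕ} {ε : ℝ}

theorem IsStableOperator.l1opLE {G : ℕ → Matrix ι κ ℝ} {R : ℝ} {ψ : ℕ → ℝ}
    (hG : IsStableOperator G R ψ) : L1opLE G R :=
  .of_l1op_le hG.summable hG.norm_le

theorem IsStableOperator.l1opLE_tail {G : ℕ → Matrix ι κ ℝ} {R θ : ℝ} {ψ : ℕ → ℝ} {n : ℕ}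
    (hG : IsStableOperator G R ψ) (hθ : ψ n ≤ θ) : L1opLE (tail n G) θ :=
  .tail_of_decay_le hG.summable ((hG.decay_le n).trans hθ)

namespace IsMarkovEstimate

theorem l1opLE_sub {G Ghat : ℕ → Matrix ι κ ℝ} (H : IsMarkovEstimate h ε G Ghat) :
    L1opLE (Ghat - G) ε :=
  .of_l1op_le H.summable H.error_le

theorem l1opLE_tail_sub {G Ghat : ℕ → Matrix ι κ ℝ} (H : IsMarkovEstimate h ε G Ghat) {θ : ℝ}
    (hG : L1opLE (NonstochasticControl.tail (h + 1) G) θ) :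
    L1opLE (NonstochasticControl.tail (h + 1) (Ghat - G)) θ := by
  refine hG.mono fun i => ?_
  rcases lt_or_ge i (h + 1) with hi | hi
  · simp only [tail_of_lt hi, le_refl]
  · rw [tail_of_le hi, tail_of_le hi, Pi.sub_apply]
    rcases H.tail i hi with e | e <;> simp [e]

theorem toRows₁ {ι' : Type} [Fintype ι'] {G Ghat : ℕ → Matrix (ι ⊕ ι') κ ℝ}
    (H : IsMarkovEstimate h ε G Ghat) :
    IsMarkovEstimate h ε (fun i => (G i).toRows₁) (fun i => (Ghat i).toRows₁) := by
  have norm_le (A : Matrix (ι ⊕ ι') κ ℝ) : ‖A.toRows₁‖ ≤ ‖A‖ := by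
    refine norm_le_of_norm_act_le (norm_nonneg _) fun x => le_trans ?_ (norm_act_le A x)
    rw [EuclideanSpace.norm_eq, EuclideanSpace.norm_eq, Fintype.sum_sum_type]
    exact Real.sqrt_le_sqrt (le_add_of_nonneg_right (sum_nonneg fun _ _ => sq_nonneg _))
  have summable : Summable fun i => ‖(Ghat i - G i).toRows₁‖ :=
    H.summable.of_nonneg_of_le (fun _ => norm_nonneg _) fun i => norm_le _
  exact
    { tail := fun i hi => (H.tail i hi).imp (fun e => by rw [e]; rfl) (fun e => by rw [e])
      summable := summable
      error_le := (summable.tsum_le_tsum (fun i => norm_le _) H.summable).trans H.error_le }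

end IsMarkovEstimate

theorem tail_tail {E : Type*} [Zero E] {k n : ℕ} (hkn : k ≤ n) (G : ℕ → E) :
    tail n (tail k G) = tail n G := by
  rw [tail, tail, tail, Set.indicator_indicator,
    Set.inter_eq_left.2 (Set.Ici_subset_Ici.2 hkn)]

variable {P : Instance dx ds dy du dη} {Ghat : ℕ → Matrix (Fin dη) (Fin du) ℝ}

theorem l1opLE_estimationError (H : IsMarkovEstimate h ε P.Gη Ghat) :
    L1opLE (estimationError P Ghat) ε :=
  H.l1opLE_sub.tail 1

theorem l1opLE_tail_estimationError (H : IsMarkovEstimate h ε P.Gη Ghat) {θ : ℝ}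
    (hG : L1opLE (tail (h + 1) P.Gη) θ) : L1opLE (tail (h + 1) (estimationError P Ghat)) θ := by
  rw [estimationError, tail_tail (Nat.le_add_left 1 h)]
  exact H.l1opLE_tail_sub hG

theorem Gη_eq_toRows₁_Gv {P : Instance dx 0 dy du dy} {K : Matrix (Fin du) (Fin dy) ℝ}
    (hP : P.ctrl = NominalController.static K) : P.Gη = fun i => (P.Gv i).toRows₁ := by
  have hC : Matrix.fromCols (P.ctrl.Dη * P.sys.C) P.ctrl.Cη =
      (Matrix.fromBlocks P.sys.C 0 (P.ctrl.D * P.sys.C) P.ctrl.C).toRows₁ := by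
    rw [hP, NominalController.static, Matrix.one_mul]
    ext a (b | b)
    · rfl
    · exact b.elim0
  funext i
  cases i with
  | zero => rfl
  | succ i => rw [Instance.Gη, hC]; rfl

end Estimates

section Algorithm

variable {m N : ℕ} {P : Instance dx ds dy du dη} {ξ : ℕ → Vec du}
  {Ghat : ℕ → Matrix (Fin dη) (Fin du) ℝ} {M : ℕ → Fin m → Matrix (Fin du) (Fin dη) ℝ}

theorem state_congr (P : Instance dx ds dy du dη) {u u' : ℕ → Vec du} :
    ∀ {t : ℕ}, (∀ j < t, u j = u' j) → P.state u t = P.state u' t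
  | 0, _ => rfl
  | t + 1, h => by
    simp only [Instance.state, state_congr P fun j hj => h j (Nat.lt_succ_of_lt hj),
      h t (Nat.lt_succ_self t)]

theorem ηHat_congr (P : Instance dx ds dy du dη) (Ghat : ℕ → Matrix (Fin dη) (Fin du) ℝ)
    {u u' : ℕ → Vec du} {t : ℕ} (h : ∀ j < t, u j = u' j) :
    P.ηHat Ghat u t = P.ηHat Ghat u' t := by
  have hsum : ∑ j ∈ range t, Ghat (t - j) *ₑ u j = ∑ j ∈ range t, Ghat (t - j) *ₑ u' j :=
    sum_congr rfl fun j hj => by rw [h j (mem_range.1 hj)]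
  simp only [Instance.ηHat, Instance.η, Instance.y, state_congr P h, hsum]

theorem algPrefix_eq_algInput {k j : ℕ} (h : j < k) :
    P.algPrefix N ξ Ghat M k j = P.algInput N ξ Ghat M j := by
  induction k, Nat.succ_le_of_lt h using Nat.le_induction with
  | base => rfl
  | succ k hjk ih => rw [Instance.algPrefix, Function.update_of_ne (by omega), ih hjk]

theorem algInput_of_le {t : ℕ} (h : N ≤ t) : P.algInput N ξ Ghat M t =
    drcInput (M t) (P.ηHat Ghat (P.algInput N ξ Ghat M)) t := by
  rw [Instance.algInput, Instance.algPrefix, Function.update_self, if_neg h.not_gt]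
  refine sum_congr rfl fun i _ => ?_
  rw [ηHat_congr P Ghat fun j hj => algPrefix_eq_algInput (hj.trans_le (Nat.sub_le t i))]

variable {ε B U : ℝ}

theorem norm_ηHat_le (hD : L1opLE (estimationError P Ghat) ε) (hη : ∀ t, ‖P.ηNat t‖ ≤ B)
    {u : ℕ → Vec du} (hu : ∀ t, ‖u t‖ ≤ U) (t : ℕ) : ‖P.ηHat Ghat u t‖ ≤ B + ε * U := by
  rw [ηHat_eq_sub_conv, Pi.sub_apply]
  exact (norm_sub_le _ _).trans (add_le_add (hη t) (hD.norm_conv_le hu t))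

theorem norm_algPrefix_le {R : ℝ} (hD : L1opLE (estimationError P Ghat) ε)
    (hη : ∀ t, ‖P.ηNat t‖ ≤ B) (hξ : ∀ t < N, ‖ξ t‖ ≤ U) (hM : ∀ t, M t ∈ drcClass du dη m R)
    (hU : 0 ≤ U) (hRU : R * (B + ε * U) ≤ U) (k t : ℕ) : ‖P.algPrefix N ξ Ghat M k t‖ ≤ U := by
  induction k generalizing t with
  | zero => simpa only [Instance.algPrefix, Pi.zero_apply, norm_zero] using hU
  | succ k ih =>
    rcases eq_or_ne t k with rfl | htk
    · rw [Instance.algPrefix, Function.update_self]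
      split_ifs with htN
      · exact hξ t htN
      · exact (norm_drcInput_le (hM t) (norm_ηHat_le hD hη ih) t).trans hRU
    · rw [Instance.algPrefix, Function.update_of_ne htk]
      exact ih t

end Algorithm

/-! ### Losses -/

namespace IsRegularLoss

variable {L : ℝ} {ℓ : VecYU dy du → ℝ}

theorem const_nonneg (h : IsRegularLoss L ℓ) : 0 ≤ L := by
  simpa using (h.nonneg 0).trans (h.le 0)

theorem le_of_norm_le (h : IsRegularLoss L ℓ) {B : ℝ} (hB : 1 ≤ B) {v : VecYU dy du}
    (hv : ‖v‖ ≤ B) : ℓ v ≤ L * B ^ 2 :=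
  (h.le v).trans <| mul_le_mul_of_nonneg_left
    (max_le (one_le_pow₀ hB) (pow_le_pow_left₀ (norm_nonneg v) hv 2)) h.const_nonneg

theorem sub_le_of_norm_le (h : IsRegularLoss L ℓ) {B : ℝ} (hB : 1 ≤ B) {v w : VecYU dy du}
    (hv : ‖v‖ ≤ B) (hw : ‖w‖ ≤ B) : ℓ v - ℓ w ≤ L * B * ‖v - w‖ := by
  have fderiv_le (x : VecYU dy du) (hx : x ∈ Metric.closedBall 0 B) : ‖fderiv ℝ ℓ x‖ ≤ L * B := by
    rw [← toDual_gradient, LinearIsometryEquiv.norm_map]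
    exact (h.grad_le x).trans <|
      mul_le_mul_of_nonneg_left (max_le hB (mem_closedBall_zero_iff.1 hx)) h.const_nonneg
  exact (le_abs_self _).trans <|
    (convex_closedBall 0 B).norm_image_sub_le_of_norm_fderiv_le
      (fun x _ => h.differentiable x) fderiv_le
      (mem_closedBall_zero_iff.2 hw) (mem_closedBall_zero_iff.2 hv)

/-- Moving `V` towards `v₀` by the fraction `α` makes room for a perturbation `d`: the result is
the convex combination of `V` and `v₀ + α⁻¹ • d` with weights `1 - α` and `α`. -/
theorem shrink_add_le (h : IsRegularLoss L ℓ) {α B : ℝ} (hα : α ∈ Set.Ioc 0 1) (hB : 1 ≤ B)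
    {v₀ : VecYU dy du} (hv₀ : ‖v₀‖ ≤ B) (V d : VecYU dy du) :
    ℓ (v₀ + (1 - α) • (V - v₀) + d) ≤ ℓ V + L * (3 * α * B ^ 2 + 2 * ‖d‖ ^ 2 / α) := by
  obtain ⟨hα0, hα1⟩ := hα
  set r := ‖d‖ / α with hr
  have hr0 : 0 ≤ r := by positivity
  have combination : v₀ + (1 - α) • (V - v₀) + d = (1 - α) • V + α • (v₀ + α⁻¹ • d) := by
    rw [smul_add, smul_smul, mul_inv_cancel₀ hα0.ne']
    module
  have norm_le : ‖v₀ + α⁻¹ • d‖ ≤ B + r := by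
    refine (norm_add_le _ _).trans (add_le_add hv₀ ?_)
    rw [norm_smul, Real.norm_of_nonneg (inv_nonneg.2 hα0.le), hr, div_eq_inv_mul]
  have loss_le : ℓ (v₀ + α⁻¹ • d) ≤ L * (3 * B ^ 2 + 2 * r ^ 2) :=
    (h.le_of_norm_le (by linarith) norm_le).trans <|
      mul_le_mul_of_nonneg_left (by nlinarith [sq_nonneg (B - r)]) h.const_nonneg
  calc ℓ (v₀ + (1 - α) • (V - v₀) + d) ≤ (1 - α) * ℓ V + α * ℓ (v₀ + α⁻¹ • d) := by
        rw [combination]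
        exact h.convex.2 (Set.mem_univ V) (Set.mem_univ _) (sub_nonneg.2 hα1) hα0.le (by ring)
    _ ≤ ℓ V + α * (L * (3 * B ^ 2 + 2 * r ^ 2)) :=
        add_le_add (mul_le_of_le_one_left (h.nonneg V) (by linarith))
          (mul_le_mul_of_nonneg_left loss_le hα0.le)
    _ = ℓ V + L * (3 * α * B ^ 2 + 2 * ‖d‖ ^ 2 / α) := by rw [hr]; field_simp

theorem sum_shrink_add_sub_le {ℓ : ℕ → VecYU dy du → ℝ} (h : ∀ t, IsRegularLoss L (ℓ t))
    {α B τ : ℝ} (hα : α ∈ Set.Ioc 0 1) (hB : 1 ≤ B) {v₀ V d : ℕ → VecYU dy du} {r : ℕ → ℝ}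
    (hv₀ : ∀ t, ‖v₀ t‖ ≤ B) (hd : ∀ t, ‖d t‖ ≤ τ + r t) (s : Finset ℕ) :
    ∑ t ∈ s, (ℓ t (v₀ t + (1 - α) • (V t - v₀ t) + d t) - ℓ t (V t)) ≤
      L * (3 * α * (B ^ 2 * #s) + 4 * (τ ^ 2 * #s + ∑ t ∈ s, r t ^ 2) / α) := by
  have hα0 : 0 ≤ α := hα.1.le
  have hL : 0 ≤ L := (h 0).const_nonneg
  have sq_le (t : ℕ) : ‖d t‖ ^ 2 ≤ 2 * (τ ^ 2 + r t ^ 2) :=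
    (pow_le_pow_left₀ (norm_nonneg _) (hd t) 2).trans add_sq_le
  calc ∑ t ∈ s, (ℓ t (v₀ t + (1 - α) • (V t - v₀ t) + d t) - ℓ t (V t))
      ≤ ∑ t ∈ s, L * (3 * α * B ^ 2 + 2 * (2 * (τ ^ 2 + r t ^ 2)) / α) :=
        sum_le_sum fun t _ => sub_le_iff_le_add'.2 <|
          ((h t).shrink_add_le hα hB (hv₀ t) (V t) (d t)).trans <| by gcongr; exact sq_le t
    _ = L * (3 * α * (B ^ 2 * #s) + 4 * (τ ^ 2 * #s + ∑ t ∈ s, r t ^ 2) / α) := by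
        rw [← mul_sum, sum_add_distrib, sum_const, ← sum_div, ← mul_sum, ← mul_sum,
          sum_add_distrib, sum_const, nsmul_eq_mul, nsmul_eq_mul]
        ring

end IsRegularLoss

section Balance

theorem exists_balanced_weight {Q : ℝ → ℝ} (hQ : Continuous Q) (hpos : ∀ α, 0 < Q α) (S : ℝ) :
    ∃ α ∈ Set.Ioc (0 : ℝ) 1, α ^ 2 * S = Q α ∨ α = 1 ∧ S ≤ Q 1 := by
  rcases le_total S (Q 1) with hS | hS
  · exact ⟨1, ⟨one_pos, le_rfl⟩, Or.inr ⟨rfl, hS⟩⟩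
  · have hcont : ContinuousOn (fun α : ℝ => α ^ 2 * S - Q α) (Set.Icc 0 1) := by fun_prop
    obtain ⟨α, ⟨hα0, hα1⟩, hα⟩ := intermediate_value_Icc zero_le_one hcont
      (show (0 : ℝ) ∈ Set.Icc _ _ from
        ⟨by simpa using (hpos 0).le, by simpa using hS⟩)
    have hαQ : α ^ 2 * S = Q α := sub_eq_zero.1 hα
    have hαne : α ≠ 0 := fun h => (hpos 0).ne (by simpa [h] using hαQ)
    exact ⟨α, ⟨hα0.lt_of_ne' hαne, hα1⟩, Or.inl hαQ⟩

theorem exists_le_seven_mul_sqrt {f Q : ℝ → ℝ} {L S : ℝ} (hQ : Continuous Q)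
    (hpos : ∀ α, 0 < Q α) (hS : 0 ≤ S) (hL : 0 ≤ L)
    (hf : ∀ α ∈ Set.Ioc (0 : ℝ) 1, f α ≤ L * (3 * α * S + 4 * Q α / α)) (hf1 : f 1 ≤ L * S) :
    ∃ α ∈ Set.Ioc (0 : ℝ) 1, f α ≤ 7 * L * √(S * Q α) := by
  obtain ⟨α, hα, hαQ | ⟨rfl, hSQ⟩⟩ := exists_balanced_weight hQ hpos S
  · have hα0 : 0 < α := hα.1
    refine ⟨α, hα, (hf α hα).trans_eq ?_⟩
    rw [← hαQ, show S * (α ^ 2 * S) = (α * S) ^ 2 by ring, Real.sqrt_sq (by positivity)]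
    field_simp
    ring
  · have hS_le : S ≤ √(S * Q 1) := Real.le_sqrt_of_sq_le (by nlinarith)
    refine ⟨1, hα, hf1.trans ?_⟩
    nlinarith [mul_le_mul_of_nonneg_left hS_le hL]

theorem sqrt_add_le_sqrt_add_sqrt {a b : ℝ} (ha : 0 ≤ a) (hb : 0 ≤ b) :
    √(a + b) ≤ √a + √b := by
  refine Real.sqrt_le_iff.2 ⟨by positivity, ?_⟩
  nlinarith [mul_nonneg (Real.sqrt_nonneg a) (Real.sqrt_nonneg b), Real.sq_sqrt ha,
    Real.sq_sqrt hb]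

theorem mul_sqrt_mul_le {a b : ℝ} (ha : 0 ≤ a) (hb : 0 ≤ b) (r : ℝ) {ν : ℝ} (hν : 0 < ν) :
    r * √(a * b) ≤ ν * b + r ^ 2 * a / (4 * ν) := by
  calc r * √(a * b) = r * (√a * √b) := by rw [Real.sqrt_mul ha]
    _ ≤ ν * √b ^ 2 + r ^ 2 * √a ^ 2 / (4 * ν) := by
        rw [← sub_nonneg]
        have square : ν * √b ^ 2 + r ^ 2 * √a ^ 2 / (4 * ν) - r * (√a * √b) =
            (ν * √b - r * √a / 2) ^ 2 / ν := by
          field_simp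
          ring
        rw [square]
        positivity
    _ = ν * b + r ^ 2 * a / (4 * ν) := by rw [Real.sq_sqrt ha, Real.sq_sqrt hb]

theorem seven_mul_sqrt_le {S A κ X Y L ν : ℝ} (hS : 0 ≤ S) (hA : 0 ≤ A) (hX : 0 ≤ X)
    (hY : 0 ≤ Y) (hL : 0 ≤ L) (hν : 0 < ν) :
    7 * L * √(S * (A ^ 2 + κ ^ 2 * (X + Y))) ≤ 7 * L * (√S * A) + 7 / 2 * L * (X + κ ^ 2 * S)
      + ν * Y + 49 / 4 * (L ^ 2 * κ ^ 2 * S / ν) := by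
  have split : √(S * (A ^ 2 + κ ^ 2 * (X + Y))) ≤
      √S * A + √(κ ^ 2 * S * X) + √(κ ^ 2 * S * Y) := by
    calc √(S * (A ^ 2 + κ ^ 2 * (X + Y)))
        = √(S * A ^ 2 + κ ^ 2 * S * X + κ ^ 2 * S * Y) := by ring_nf
      _ ≤ √(S * A ^ 2) + √(κ ^ 2 * S * X) + √(κ ^ 2 * S * Y) :=
          (sqrt_add_le_sqrt_add_sqrt (by positivity) (by positivity)).trans <|
            add_le_add_left (sqrt_add_le_sqrt_add_sqrt (by positivity) (by positivity)) _
      _ = √S * A + √(κ ^ 2 * S * X) + √(κ ^ 2 * S * Y) := by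
          rw [Real.sqrt_mul hS, Real.sqrt_sq hA]
  have hκS : 0 ≤ κ ^ 2 * S := by positivity
  have mean_X : √(κ ^ 2 * S * X) ≤ 1 / 2 * (X + κ ^ 2 * S) :=
    (one_mul _).ge.trans <| (mul_sqrt_mul_le hκS hX 1 one_half_pos).trans_eq (by ring)
  have mean_Y : 7 * L * √(κ ^ 2 * S * Y) ≤ ν * Y + 49 / 4 * (L ^ 2 * κ ^ 2 * S / ν) :=
    (mul_sqrt_mul_le hκS hY (7 * L) hν).trans_eq (by ring)
  calc 7 * L * √(S * (A ^ 2 + κ ^ 2 * (X + Y)))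
      ≤ 7 * L * (√S * A + √(κ ^ 2 * S * X) + √(κ ^ 2 * S * Y)) := by gcongr
    _ = 7 * L * (√S * A) + 7 * L * √(κ ^ 2 * S * X) + 7 * L * √(κ ^ 2 * S * Y) := by ring
    _ ≤ 7 * L * (√S * A) + 7 * L * (1 / 2 * (X + κ ^ 2 * S))
          + (ν * Y + 49 / 4 * (L ^ 2 * κ ^ 2 * S / ν)) := by gcongr
    _ = 7 * L * (√S * A) + 7 / 2 * L * (X + κ ^ 2 * S) + ν * Y
          + 49 / 4 * (L ^ 2 * κ ^ 2 * S / ν) := by ring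

end Balance

/-! ### Parameters -/

/-- A bound on the exogenous inputs of the algorithm, in the exploration rounds and afterwards. -/
def Params.inputBound (p : Params) (du : ℕ) : ℝ := max (p.Ruest du) (2 * p.RM * p.Rnat)

/-- The part of the distance between the response to the comparator and the shrunk response of the
policy that comes from truncation (first term) and from the second order of the estimation error
(second term). -/
def Params.deviation (p : Params) (du : ℕ) : ℝ :=
  p.c * p.R0 ^ 2 * p.RM * p.inputBound du / p.T + p.R0 * p.RM ^ 3 * p.ε ^ 2 * p.Rnat

namespace Params.Admissible

variable {p : Params} (hp : p.Admissible)

include hp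

theorem T_pos : (0 : ℝ) < p.T :=
  Nat.cast_pos.2 hp.one_le_T

theorem log_nonneg : 0 ≤ Real.log (1 / p.δ) :=
  Real.log_nonneg ((one_le_div₀ hp.δ_pos).2 hp.δ_lt_one.le)

theorem two_mul_Rnat_le_inputBound (du : ℕ) : 2 * p.Rnat ≤ p.inputBound du := by
  have hRM : 1 ≤ p.RM := hp.one_le_RM
  have hRn : 1 ≤ p.Rnat := hp.one_le_Rnat
  exact le_max_of_le_right (by nlinarith)

theorem inputBound_pos (du : ℕ) : 0 < p.inputBound du := by
  linarith [hp.two_mul_Rnat_le_inputBound du, hp.one_le_Rnat]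

theorem inputBound_sq_le (du : ℕ) :
    p.inputBound du ^ 2 ≤ 9 * (du + Real.log (1 / p.δ) + p.RM ^ 4 * p.Rnat ^ 2) := by
  have hlog : 0 ≤ Real.log (1 / p.δ) := hp.log_nonneg
  have hRM : p.RM ^ 2 * p.Rnat ^ 2 ≤ p.RM ^ 4 * p.Rnat ^ 2 :=
    mul_le_mul_of_nonneg_right (pow_le_pow_right₀ hp.one_le_RM (by norm_num)) (sq_nonneg _)
  rcases max_choice (p.Ruest du) (2 * p.RM * p.Rnat) with h | h
  · rw [inputBound, h, Ruest, mul_pow, Real.sq_sqrt (by positivity)]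
    nlinarith [mul_nonneg (sq_nonneg p.RM) (sq_nonneg p.Rnat)]
  · rw [inputBound, h]
    nlinarith [mul_nonneg (sq_nonneg p.RM) (sq_nonneg p.Rnat)]

theorem deviation_pos (hR : 1 ≤ p.R0) (du : ℕ) : 0 < p.deviation du := by
  have hT : (0 : ℝ) < p.T := hp.T_pos
  have hc : 1 ≤ p.c := hp.one_le_c
  have hRM : 1 ≤ p.RM := hp.one_le_RM
  have hRn : 1 ≤ p.Rnat := hp.one_le_Rnat
  have hU : 0 < p.inputBound du := hp.inputBound_pos du
  exact add_pos_of_pos_of_nonneg (by positivity) (by positivity)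

theorem truncation_terms_le (hR : 1 ≤ p.R0) (hs : 0 ≤ p.Rstar) (du : ℕ) :
    p.c * p.R0 / p.T * (p.Rstar * p.Rnat) + p.R0 * (p.c * p.Rstar / p.T * p.Rnat)
        + p.R0 * (p.Rstar * (p.c * p.R0 / p.T * p.inputBound du)) ≤
      p.c * p.R0 ^ 2 * p.RM * p.inputBound du / p.T := by
  have hT : (0 : ℝ) < p.T := hp.T_pos
  have hc : 1 ≤ p.c := hp.one_le_c
  have hU : 0 < p.inputBound du := hp.inputBound_pos du
  have two_Rnat_le : 2 * p.Rnat ≤ p.R0 * p.inputBound du :=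
    (hp.two_mul_Rnat_le_inputBound du).trans (le_mul_of_one_le_left hU.le hR)
  calc _ = p.c * p.R0 * (p.Rstar * (2 * p.Rnat + p.R0 * p.inputBound du)) / p.T := by
        field_simp
        ring
    _ ≤ p.c * p.R0 * (p.Rstar * (2 * (p.R0 * p.inputBound du))) / p.T := by
        gcongr
        linarith
    _ = p.c * p.R0 * (2 * p.Rstar * (p.R0 * p.inputBound du)) / p.T := by ring
    _ ≤ p.c * p.R0 * (p.RM * (p.R0 * p.inputBound du)) / p.T := by
        gcongr
        exact hp.two_Rstar_le_RM
    _ = p.c * p.R0 ^ 2 * p.RM * p.inputBound du / p.T := by ring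

theorem second_order_term_le (hR : 1 ≤ p.R0) (hs : 0 ≤ p.Rstar) :
    p.R0 * (p.Rstar * (p.ε * (p.Rstar * (p.ε * (p.Rstar * (2 * p.Rnat)))))) ≤
      p.R0 * p.RM ^ 3 * p.ε ^ 2 * p.Rnat := by
  have hRn : 1 ≤ p.Rnat := hp.one_le_Rnat
  have cube_le : 2 * p.Rstar ^ 3 ≤ p.RM ^ 3 := by
    have := pow_le_pow_left₀ (by positivity) hp.two_Rstar_le_RM 3
    nlinarith [pow_nonneg hs 3]
  calc _ = p.R0 * (2 * p.Rstar ^ 3) * p.ε ^ 2 * p.Rnat := by ring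
    _ ≤ p.R0 * p.RM ^ 3 * p.ε ^ 2 * p.Rnat := by gcongr

end Params.Admissible

namespace GoodExploration

variable {p : Params} {ξ : ℕ → Vec du} (hξ : GoodExploration p ξ)

include hξ

theorem ε_mul_max_le_one (hp : p.Admissible) (hR : 1 ≤ p.R0) :
    p.ε * max (p.Ruest du) (2 * p.RM * p.R0) ≤ 1 := by
  have hRM : 1 ≤ p.RM := hp.one_le_RM
  exact (le_div_iff₀ (lt_max_of_lt_right (by positivity))).1 hξ.ε_le

theorem ε_mul_RM_le_one (hp : p.Admissible) (hR : 1 ≤ p.R0) (hε : 0 ≤ p.ε) :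
    p.ε * (2 * p.RM) ≤ 1 := by
  have hRM : 1 ≤ p.RM := hp.one_le_RM
  refine le_trans ?_ (hξ.ε_mul_max_le_one hp hR)
  gcongr
  exact le_max_of_le_right (le_mul_of_one_le_right (by positivity) hR)

theorem ε_mul_inputBound_le (hp : p.Admissible) (hR : 1 ≤ p.R0) (hε : 0 ≤ p.ε) :
    p.ε * p.inputBound du ≤ p.Rnat := by
  have hRn : 1 ≤ p.Rnat := hp.one_le_Rnat
  rw [Params.inputBound, mul_max_of_nonneg _ _ hε]
  refine max_le ?_ ?_
  · calc p.ε * p.Ruest du ≤ p.ε * max (p.Ruest du) (2 * p.RM * p.R0) := by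
          gcongr
          exact le_max_left _ _
      _ ≤ p.Rnat := (hξ.ε_mul_max_le_one hp hR).trans hRn
  · calc p.ε * (2 * p.RM * p.Rnat) = p.ε * (2 * p.RM) * p.Rnat := by ring
      _ ≤ p.Rnat := mul_le_of_le_one_left (by positivity) (hξ.ε_mul_RM_le_one hp hR hε)

end GoodExploration

section Boundedness

variable {P : Instance dx ds dy du dη} {p : Params} {ξ : ℕ → Vec du}
  {Ghat : ℕ → Matrix (Fin dη) (Fin du) ℝ} {M : ℕ → Fin p.m → Matrix (Fin du) (Fin dη) ℝ}

theorem one_le_of_isStableOperator_Gv {R : ℝ} {ψ : ℕ → ℝ} (h : IsStableOperator P.Gv R ψ)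
    (hdu : du ≠ 0) : 1 ≤ R := by
  have : NeZero du := ⟨hdu⟩
  set b : Vec du := EuclideanSpace.single 0 1 with hb
  have norm_b : ‖b‖ = 1 := by simp [hb]
  have norm_stack : ‖stack (0 : Vec dy) b‖ = ‖b‖ := by
    rw [EuclideanSpace.norm_eq, EuclideanSpace.norm_eq, Fintype.sum_sum_type]
    simp [stack]
  calc 1 = ‖P.Gv 0 *ₑ b‖ := by
        rw [Instance.Gv, fromRows_act, zero_act, one_act, norm_stack, norm_b]
    _ ≤ ‖P.Gv 0‖ := (norm_act_le _ _).trans_eq (by rw [norm_b, mul_one])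
    _ ≤ R := by simpa using h.l1opLE 1

theorem norm_algInput_le (hp : p.Admissible) (hP : P.Regular p) (hξ : GoodExploration p ξ)
    (hη : IsMarkovEstimate p.h p.ε P.Gη Ghat) (hR : 1 ≤ p.R0)
    (hM : ∀ t, M t ∈ drcClass du dη p.m p.RM) (t : ℕ) :
    ‖P.algInput p.N ξ Ghat M t‖ ≤ p.inputBound du := by
  have hD : L1opLE (estimationError P Ghat) p.ε := l1opLE_estimationError hη
  have hRM : 1 ≤ p.RM := hp.one_le_RM
  have self_bound : p.RM * (p.Rnat + p.ε * p.inputBound du) ≤ p.inputBound du :=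
    calc p.RM * (p.Rnat + p.ε * p.inputBound du) ≤ p.RM * (p.Rnat + p.Rnat) := by
          gcongr
          exact hξ.ε_mul_inputBound_le hp hR hD.nonneg
      _ = 2 * p.RM * p.Rnat := by ring
      _ ≤ p.inputBound du := le_max_right _ _
  exact norm_algPrefix_le hD hP.ηNat_le (fun t ht => (hξ.input_le t ht).trans (le_max_left _ _))
    hM (hp.inputBound_pos du).le self_bound _ t

theorem norm_ηHat_le_two_mul_Rnat (hp : p.Admissible) (hP : P.Regular p)
    (hξ : GoodExploration p ξ) (hη : IsMarkovEstimate p.h p.ε P.Gη Ghat) (hR : 1 ≤ p.R0)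
    {u : ℕ → Vec du} (hu : ∀ t, ‖u t‖ ≤ p.inputBound du) (t : ℕ) :
    ‖P.ηHat Ghat u t‖ ≤ 2 * p.Rnat := by
  have hD : L1opLE (estimationError P Ghat) p.ε := l1opLE_estimationError hη
  have := norm_ηHat_le hD hP.ηNat_le hu t
  linarith [hξ.ε_mul_inputBound_le hp hR hD.nonneg]

theorem norm_drcInput_le_inputBound {x : ℕ → Vec dη} (hx : ∀ t, ‖x t‖ ≤ 2 * p.Rnat)
    {M : Fin p.m → Matrix (Fin du) (Fin dη) ℝ} (hM : M ∈ drcClass du dη p.m p.RM) (t : ℕ) :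
    ‖drcInput M x t‖ ≤ p.inputBound du :=
  (norm_drcInput_le hM hx t).trans <|
    (show p.RM * (2 * p.Rnat) = 2 * p.RM * p.Rnat by ring).trans_le (le_max_right _ _)

end Boundedness

/-! ### The comparator -/

section ComparatorOperator

variable {Gc G Gt : ℕ → Matrix (Fin du) (Fin dη) ℝ} {D Dh Dt : ℕ → Matrix (Fin dη) (Fin du) ℝ}
  {β : ℝ}

/-- The comparator for the policy with conversion operator `G`, shrunk by the factor `β`, when the
reconstruction has the estimation error `D`. Its inputs should be `w = β • G ⋆ ηⁿᵃᵗ`, and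
`ηⁿᵃᵗ = η̂ⁿᵃᵗ + D ⋆ w` if they are played; these are the first two terms of the Neumann series of
the solution `w`. -/
def comparatorOp (β : ℝ) (G : ℕ → Matrix (Fin du) (Fin dη) ℝ)
    (D : ℕ → Matrix (Fin dη) (Fin du) ℝ) : ℕ → Matrix (Fin du) (Fin dη) ℝ :=
  β • G + β ^ 2 • mconv G (mconv D G)

theorem conv_comparatorOp (β : ℝ) (G : ℕ → Matrix (Fin du) (Fin dη) ℝ)
    (D : ℕ → Matrix (Fin dη) (Fin du) ℝ) (x : ℕ → Vec dη) :
    comparatorOp β G D ⋆ x = β • (G ⋆ x) + β ^ 2 • (G ⋆ D ⋆ G ⋆ x) := by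
  rw [comparatorOp, map_add, map_smul, map_smul, conv_conv D, conv_conv]
  rfl

theorem comparatorOp_zero_left : comparatorOp 0 G D = 0 := by
  simp [comparatorOp]

theorem comparatorOp_eq_zero {k h m i : ℕ} (hG : ∀ i, k ≤ i → G i = 0)
    (hD : ∀ i, h + 1 ≤ i → D i = 0) (hm : 2 * k + h ≤ m) (hi : m ≤ i) :
    comparatorOp β G D i = 0 := by
  have hDG (j : ℕ) (hj : h + k ≤ j) : mconv D G j = 0 := mconv_eq_zero hD hG (by omega)
  have hGDG : mconv G (mconv D G) i = 0 := mconv_eq_zero hG hDG (by omega)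
  simp [comparatorOp, hG i (by omega), hGDG]

theorem l1opLE_comparatorOp (hβ : β ∈ Set.Icc 0 1) {g ε : ℝ} (hG : L1opLE G g)
    (hD : L1opLE D ε) : L1opLE (comparatorOp β G D) (g + g * (ε * g)) := fun T => by
  have hg : 0 ≤ g := hG.nonneg
  have hGDG : L1opLE (mconv G (mconv D G)) (g * (ε * g)) := hG.mconv (hD.mconv hG)
  exact ((hG.smul hβ.1).add (hGDG.smul (sq_nonneg β)) T).trans <|
    add_le_add (mul_le_of_le_one_left hg hβ.2)
      (mul_le_of_le_one_left hGDG.nonneg (pow_le_one₀ hβ.1 hβ.2))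

variable {u w : ℕ → Vec du} {n x : ℕ → Vec dη}

theorem smul_conv_sub_conv_comparatorOp (hG : G + Gt = Gc) (hD : Dh + Dt = D)
    (hx : x = n - D ⋆ u) (hw : w = comparatorOp β G Dh ⋆ x) :
    β • (Gc ⋆ n) - w = β • (Gt ⋆ n) + β • (G ⋆ Dt ⋆ u) + β • (G ⋆ Dh ⋆ (u - w))
      + β ^ 3 • (G ⋆ Dh ⋆ G ⋆ Dh ⋆ G ⋆ x) := by
  have expand_n : n = x + Dh ⋆ u + Dt ⋆ u := by
    rw [hx, ← hD, map_add, LinearMap.add_apply]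
    abel
  have expand_Gc : Gc ⋆ n = G ⋆ x + G ⋆ Dh ⋆ u + G ⋆ Dt ⋆ u + Gt ⋆ n := by
    rw [← hG, map_add, LinearMap.add_apply, ← map_add, ← map_add, ← expand_n]
  have expand_w : G ⋆ Dh ⋆ w = β • (G ⋆ Dh ⋆ G ⋆ x) + β ^ 2 • (G ⋆ Dh ⋆ G ⋆ Dh ⋆ G ⋆ x) := by
    simp only [hw, conv_comparatorOp, map_add, map_smul]
  rw [expand_Gc, map_sub, map_sub, expand_w, hw, conv_comparatorOp]
  module

variable {Gv : ℕ → Matrix (Fin dy ⊕ Fin du) (Fin du) ℝ} {k l : ℕ}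

theorem conv_sub_smul_conv_comparatorOp (hx : x = n - D ⋆ u)
    (hw : w = comparatorOp β (trunc k Gc) (trunc l D) ⋆ x) :
    trunc l Gv ⋆ w - β • (Gv ⋆ Gc ⋆ n) =
      -(β • (tail l Gv ⋆ Gc ⋆ n + trunc l Gv ⋆ tail k Gc ⋆ n
          + trunc l Gv ⋆ trunc k Gc ⋆ tail l D ⋆ u)
        + β ^ 3 • (trunc l Gv ⋆ trunc k Gc ⋆ trunc l D ⋆ trunc k Gc ⋆ trunc l D ⋆ trunc k Gc ⋆ x)
        + β • (trunc l Gv ⋆ trunc k Gc ⋆ trunc l D ⋆ (u - w))) := by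
  have split_Gv : Gv ⋆ Gc ⋆ n = trunc l Gv ⋆ Gc ⋆ n + tail l Gv ⋆ Gc ⋆ n := by
    rw [← LinearMap.add_apply, ← map_add, trunc_add_tail]
  have response := congrArg (trunc l Gv ⋆ ·) <|
    smul_conv_sub_conv_comparatorOp (trunc_add_tail k Gc) (trunc_add_tail l D) hx hw
  simp only [map_sub (conv (trunc l Gv)), map_add (conv (trunc l Gv)),
    map_smul (conv (trunc l Gv))] at response
  rw [split_Gv, ← sub_sub_self (β • (trunc l Gv ⋆ Gc ⋆ n)) (trunc l Gv ⋆ w), response]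
  module

theorem norm_conv_sub_smul_conv_comparatorOp_le {R₀ R ε θv θc θd B X U : ℝ} (hβ : β ∈ Set.Icc 0 1)
    (hGv : L1opLE Gv R₀) (hGc : L1opLE Gc R) (hD : L1opLE D ε) (hGv' : L1opLE (tail l Gv) θv)
    (hGc' : L1opLE (tail k Gc) θc) (hD' : L1opLE (tail l D) θd) (hn : ∀ t, ‖n t‖ ≤ B)
    (hxX : ∀ t, ‖x t‖ ≤ X) (hu : ∀ t, ‖u t‖ ≤ U) (hx : x = n - D ⋆ u)
    (hw : w = comparatorOp β (trunc k Gc) (trunc l D) ⋆ x) (t : ℕ) :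
    ‖(trunc l Gv ⋆ w - β • (Gv ⋆ Gc ⋆ n)) t‖ ≤
      θv * (R * B) + R₀ * (θc * B) + R₀ * (R * (θd * U)) + R₀ * (R * (ε * (R * (ε * (R * X)))))
        + ‖(trunc l Gv ⋆ trunc k Gc ⋆ trunc l D ⋆ (u - w)) t‖ := by
  have smul_le {r : ℝ} (hr : r ∈ Set.Icc 0 1) (z : VecYU dy du) : ‖r • z‖ ≤ ‖z‖ := by
    rw [norm_smul, Real.norm_of_nonneg hr.1]
    exact mul_le_of_le_one_left (norm_nonneg z) hr.2
  have hV : L1opLE (trunc l Gv) R₀ := hGv.trunc l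
  have hG : L1opLE (trunc k Gc) R := hGc.trunc k
  have hE : L1opLE (trunc l D) ε := hD.trunc l
  rw [conv_sub_smul_conv_comparatorOp hx hw, Pi.neg_apply, norm_neg]
  refine norm_add_le_of_le (norm_add_le_of_le ((smul_le hβ _).trans ?_)
    ((smul_le ⟨pow_nonneg hβ.1 3, pow_le_one₀ hβ.1 hβ.2⟩ _).trans ?_)) (smul_le hβ _)
  · exact norm_add_le_of_le (norm_add_le_of_le (hGv'.norm_conv_le (hGc.norm_conv_le hn) t)
      (hV.norm_conv_le (hGc'.norm_conv_le hn) t))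
      (hV.norm_conv_le (hG.norm_conv_le (hD'.norm_conv_le hu)) t)
  · exact hV.norm_conv_le (hG.norm_conv_le (hE.norm_conv_le (hG.norm_conv_le
      (hE.norm_conv_le (hG.norm_conv_le hxX))))) t

end ComparatorOperator

/-- The total squared distance of the inputs `u` to those of the controller parameter `M`. -/
def inputDist {m : ℕ} (T : ℕ) (u : ℕ → Vec du) (η : ℕ → Vec dη)
    (M : Fin m → Matrix (Fin du) (Fin dη) ℝ) : ℝ :=
  ∑ t ∈ range T, ‖u t - drcInput M η t‖ ^ 2

/-- The comparator for the policy with conversion operator `Gc`, as a parameter of the algorithm: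
`comparatorOp` is applied to truncations of `Gc` and of the estimation error, so that it vanishes
from lag `2 * mstar + h ≤ m` on. -/
def comparator (P : Instance dx ds dy du dη) (p : Params) (Gc : ℕ → Matrix (Fin du) (Fin dη) ℝ)
    (Ghat : ℕ → Matrix (Fin dη) (Fin du) ℝ) (β : ℝ) : Fin p.m → Matrix (Fin du) (Fin dη) ℝ :=
  fun i => comparatorOp β (trunc p.mstar Gc) (trunc (p.h + 1) (estimationError P Ghat)) i

section Comparator

variable {P : Instance dx ds dy du dη} {p : Params} {Gc : ℕ → Matrix (Fin du) (Fin dη) ℝ}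
  {Ghat : ℕ → Matrix (Fin dη) (Fin du) ℝ} {u : ℕ → Vec du} {x : ℕ → Vec dη}

theorem comparator_mem_drcClass (hp : p.Admissible) (hGc : L1opLE Gc p.Rstar)
    (hD : L1opLE (estimationError P Ghat) p.ε) (hε : p.ε * (2 * p.RM) ≤ 1) {β : ℝ}
    (hβ : β ∈ Set.Icc 0 1) : comparator P p Gc Ghat β ∈ drcClass du dη p.m p.RM := by
  have hs : 0 ≤ p.Rstar := hGc.nonneg
  have ε_mul_Rstar_le : p.ε * p.Rstar ≤ 1 := by
    nlinarith [mul_le_mul_of_nonneg_left hp.two_Rstar_le_RM hD.nonneg, hD.nonneg]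
  calc ∑ i, ‖comparator P p Gc Ghat β i‖
    _ = ∑ i ∈ range p.m,
          ‖comparatorOp β (trunc p.mstar Gc) (trunc (p.h + 1) (estimationError P Ghat)) i‖ :=
        Fin.sum_univ_eq_sum_range (fun i => ‖comparatorOp β _ _ i‖) p.m
    _ ≤ p.Rstar + p.Rstar * (p.ε * p.Rstar) :=
        l1opLE_comparatorOp hβ (hGc.trunc _) (hD.trunc _) p.m
    _ ≤ p.Rstar + p.Rstar := by
        gcongr
        exact mul_le_of_le_one_right hs ε_mul_Rstar_le
    _ ≤ p.RM := (two_mul p.Rstar).symm.trans_le hp.two_Rstar_le_RM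

theorem drcInput_comparator (hp : p.Admissible) (β : ℝ) (x : ℕ → Vec dη) :
    drcInput (comparator P p Gc Ghat β) x =
      comparatorOp β (trunc p.mstar Gc) (trunc (p.h + 1) (estimationError P Ghat)) ⋆ x := by
  refine (drcInput_eq_trunc_conv _ x).trans (congrArg (· ⋆ x) <| Set.indicator_eq_self.2 ?_)
  refine Function.support_subset_iff'.2 fun i hi => ?_
  exact comparatorOp_eq_zero (fun _ h => trunc_of_le h _) (fun _ h => trunc_of_le h _) hp.m_ge
    (not_lt.1 hi)

theorem memLoss_comparator (β : ℝ) (x : ℕ → Vec dη) (t : ℕ) :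
    P.memLoss p.h x t (fun _ => embed (comparator P p Gc Ghat β)) =
      P.loss t (P.vNat t + (trunc (p.h + 1) P.Gv ⋆ drcInput (comparator P p Gc Ghat β) x) t) :=
  memLoss_embed P p.h x t fun _ => comparator P p Gc Ghat β

theorem continuous_inputDist_comparator (hp : p.Admissible) (u : ℕ → Vec du) (x : ℕ → Vec dη) :
    Continuous fun β => inputDist p.T u x (comparator P p Gc Ghat β) := by
  simp only [inputDist, drcInput_comparator hp, conv_comparatorOp, Pi.add_apply, Pi.smul_apply]
  fun_prop

theorem norm_response_comparator_sub_le (hp : p.Admissible) (hP : P.Regular p) (hR : 1 ≤ p.R0)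
    (hGc : IsStableOperator Gc p.Rstar p.ψstar) (hη : IsMarkovEstimate p.h p.ε P.Gη Ghat)
    (hu : ∀ t, ‖u t‖ ≤ p.inputBound du) (hx : x = P.ηHat Ghat u) (hxb : ∀ t, ‖x t‖ ≤ 2 * p.Rnat)
    {β : ℝ} (hβ : β ∈ Set.Icc 0 1) (t : ℕ) :
    ‖(trunc (p.h + 1) P.Gv ⋆ drcInput (comparator P p Gc Ghat β) x
        - β • (P.Gv ⋆ Gc ⋆ P.ηNat)) t‖ ≤ p.deviation du
      + ‖(trunc (p.h + 1) P.Gv ⋆ trunc p.mstar Gc ⋆ trunc (p.h + 1) (estimationError P Ghat) ⋆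
          (u - drcInput (comparator P p Gc Ghat β) x)) t‖ := by
  have hs : 0 ≤ p.Rstar := hGc.l1opLE.nonneg
  refine (norm_conv_sub_smul_conv_comparatorOp_le hβ hP.Gv.l1opLE hGc.l1opLE
    (l1opLE_estimationError hη) (hP.Gv.l1opLE_tail hp.ψ0_le) (hGc.l1opLE_tail hp.ψstar_le)
    (l1opLE_tail_estimationError hη (hP.Gη.l1opLE_tail hp.ψ0_le)) hP.ηNat_le hxb hu
    (hx.trans (ηHat_eq_sub_conv P u Ghat)) (drcInput_comparator hp β x) t).trans ?_
  gcongr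
  exact add_le_add (hp.truncation_terms_le hR hs du) (hp.second_order_term_le hR hs)

theorem sum_norm_sq_first_order_le (hp : p.Admissible) (hP : P.Regular p)
    (hGc : L1opLE Gc p.Rstar) (hη : IsMarkovEstimate p.h p.ε P.Gη Ghat) (d : ℕ → Vec du) (T : ℕ) :
    ∑ t ∈ range T, ‖(trunc (p.h + 1) P.Gv ⋆ trunc p.mstar Gc ⋆
        trunc (p.h + 1) (estimationError P Ghat) ⋆ d) t‖ ^ 2 ≤
      (p.R0 * p.RM * p.ε) ^ 2 * ∑ t ∈ range T, ‖d t‖ ^ 2 := by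
  have hV : L1opLE (trunc (p.h + 1) P.Gv) p.R0 := hP.Gv.l1opLE.trunc _
  have hG : L1opLE (trunc p.mstar Gc) p.Rstar := hGc.trunc _
  have hE : L1opLE (trunc (p.h + 1) (estimationError P Ghat)) p.ε :=
    (l1opLE_estimationError hη).trunc _
  have hR0 : 0 ≤ p.R0 := hV.nonneg
  have hs : 0 ≤ p.Rstar := hG.nonneg
  have hε : 0 ≤ p.ε := hE.nonneg
  rw [conv_conv (trunc p.mstar Gc), conv_conv (trunc (p.h + 1) P.Gv)]
  refine ((hV.mconv (hG.mconv hE)).sum_norm_conv_sq_le d T).trans ?_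
  rw [mul_assoc p.R0]
  gcongr
  linarith [hp.two_Rstar_le_RM]

theorem sum_memLoss_comparator_sub_le (hp : p.Admissible) (hP : P.Regular p) (hR : 1 ≤ p.R0)
    (hGc : IsStableOperator Gc p.Rstar p.ψstar) (hη : IsMarkovEstimate p.h p.ε P.Gη Ghat)
    (hu : ∀ t, ‖u t‖ ≤ p.inputBound du) (hx : x = P.ηHat Ghat u) (hxb : ∀ t, ‖x t‖ ≤ 2 * p.Rnat)
    {π : LDC dy du} (hπ : P.IsConversion π Gc) {α : ℝ} (hα : α ∈ Set.Ioc 0 1) (a : ℕ) :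
    ∑ t ∈ Ico a p.T, (P.memLoss p.h x t (fun _ => embed (comparator P p Gc Ghat (1 - α)))
        - P.loss t (P.ldcV π t)) ≤
      p.L * (3 * α * (p.Rnat ^ 2 * p.T) + 4 * (p.deviation du ^ 2 * p.T
        + (p.R0 * p.RM * p.ε) ^ 2 * inputDist p.T u x (comparator P p Gc Ghat (1 - α))) / α) := by
  have hα0 : 0 < α := hα.1
  have hL : 0 ≤ p.L := (hP.loss 0).const_nonneg
  set w := drcInput (comparator P p Gc Ghat (1 - α)) x with hw
  set d := trunc (p.h + 1) P.Gv ⋆ w - (1 - α) • (P.Gv ⋆ Gc ⋆ P.ηNat) with hd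
  set r := trunc (p.h + 1) P.Gv ⋆ trunc p.mstar Gc ⋆
    trunc (p.h + 1) (estimationError P Ghat) ⋆ (u - w)
  have response (t : ℕ) : P.vNat t + (trunc (p.h + 1) P.Gv ⋆ w) t =
      P.vNat t + (1 - α) • (P.ldcV π t - P.vNat t) + d t := by
    rw [hd, ldcV_eq_vNat_add_conv hπ, Pi.add_apply, Pi.sub_apply, Pi.smul_apply]
    module
  have norm_d_le (t : ℕ) : ‖d t‖ ≤ p.deviation du + ‖r t‖ :=
    norm_response_comparator_sub_le hp hP hR hGc hη hu hx hxb
      ⟨sub_nonneg.2 hα.2, sub_le_self 1 hα0.le⟩ t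
  have card_le : (#(Ico a p.T) : ℝ) ≤ p.T := by simp
  have sum_r_le : ∑ t ∈ Ico a p.T, ‖r t‖ ^ 2 ≤
      (p.R0 * p.RM * p.ε) ^ 2 * ∑ t ∈ range p.T, ‖(u - w) t‖ ^ 2 :=
    (sum_le_sum_of_subset_of_nonneg (fun t ht => mem_range.2 (mem_Ico.1 ht).2)
      fun _ _ _ => sq_nonneg _).trans
      (sum_norm_sq_first_order_le hp hP hGc.l1opLE hη (u - w) p.T)
  simp only [memLoss_comparator, ← hw, response]
  refine (IsRegularLoss.sum_shrink_add_sub_le hP.loss hα hp.one_le_Rnat hP.vNat_le norm_d_le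
    _).trans ?_
  gcongr
  exact sum_r_le

theorem sum_memLoss_comparator_zero_sub_le (hp : p.Admissible) (hP : P.Regular p)
    (V : ℕ → VecYU dy du) (x : ℕ → Vec dη) (a : ℕ) :
    ∑ t ∈ Ico a p.T, (P.memLoss p.h x t (fun _ => embed (comparator P p Gc Ghat 0))
        - P.loss t (V t)) ≤ p.L * (p.Rnat ^ 2 * p.T) := by
  have hL : 0 ≤ p.L := (hP.loss 0).const_nonneg
  have loss_le (t : ℕ) : P.memLoss p.h x t (fun _ => embed (comparator P p Gc Ghat 0))
      - P.loss t (V t) ≤ p.L * p.Rnat ^ 2 := by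
    rw [memLoss_comparator, drcInput_comparator hp, comparatorOp_zero_left, map_zero,
      LinearMap.zero_apply, map_zero, Pi.zero_apply, add_zero]
    exact (sub_le_self _ ((hP.loss t).nonneg _)).trans
      ((hP.loss t).le_of_norm_le hp.one_le_Rnat (hP.vNat_le t))
  calc _ ≤ #(Ico a p.T) • (p.L * p.Rnat ^ 2) := sum_le_card_nsmul _ _ _ fun t _ => loss_le t
    _ ≤ p.T * (p.L * p.Rnat ^ 2) := by
        rw [nsmul_eq_mul]
        gcongr
        simp
    _ = p.L * (p.Rnat ^ 2 * p.T) := by ring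

theorem exists_mem_drcClass_sum_memLoss_sub_le (hp : p.Admissible) (hP : P.Regular p)
    (hR : 1 ≤ p.R0) (hη : IsMarkovEstimate p.h p.ε P.Gη Ghat) (hε : p.ε * (2 * p.RM) ≤ 1)
    (hu : ∀ t, ‖u t‖ ≤ p.inputBound du) (hx : x = P.ηHat Ghat u) (hxb : ∀ t, ‖x t‖ ≤ 2 * p.Rnat)
    {π : LDC dy du} (hπ : π ∈ P.policyClass p.Rstar p.ψstar) (a : ℕ) :
    ∃ Mstar ∈ drcClass du dη p.m p.RM,
      ∑ t ∈ Ico a p.T, (P.memLoss p.h x t (fun _ => embed Mstar) - P.loss t (P.ldcV π t)) ≤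
        7 * p.L * √(p.Rnat ^ 2 * p.T * (p.deviation du ^ 2 * p.T
          + (p.R0 * p.RM * p.ε) ^ 2 * inputDist p.T u x Mstar)) := by
  obtain ⟨Gc, hconv, hsum, hl1, hdec⟩ := hπ
  have hGc : IsStableOperator Gc p.Rstar p.ψstar := ⟨hsum, hl1, hdec⟩
  have hT : (0 : ℝ) < p.T := hp.T_pos
  have hτ : 0 < p.deviation du := hp.deviation_pos hR du
  have inputDist_nonneg (β : ℝ) : 0 ≤ inputDist p.T u x (comparator P p Gc Ghat β) :=
    sum_nonneg fun _ _ => sq_nonneg _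
  have hcont : Continuous fun α => inputDist p.T u x (comparator P p Gc Ghat (1 - α)) :=
    (continuous_inputDist_comparator hp u x).comp (continuous_sub_left 1)
  obtain ⟨α, hα, hle⟩ := exists_le_seven_mul_sqrt
    (Q := fun α => p.deviation du ^ 2 * p.T
      + (p.R0 * p.RM * p.ε) ^ 2 * inputDist p.T u x (comparator P p Gc Ghat (1 - α)))
    (by fun_prop)
    (fun α => add_pos_of_pos_of_nonneg (by positivity)
      (mul_nonneg (sq_nonneg _) (inputDist_nonneg _)))
    (by positivity : 0 ≤ p.Rnat ^ 2 * p.T) (hP.loss 0).const_nonneg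
    (fun α hα => sum_memLoss_comparator_sub_le hp hP hR hGc hη hu hx hxb hconv hα a)
    (by simpa only [sub_self] using sum_memLoss_comparator_zero_sub_le hp hP (P.ldcV π) x a)
  exact ⟨_, comparator_mem_drcClass hp hGc.l1opLE (l1opLE_estimationError hη) hε
    ⟨sub_nonneg.2 hα.2, sub_le_self 1 hα.1.le⟩, hle⟩

end Comparator

/-! ### Regret -/

/-- The burn-in term of the regret bound: the cost of the `N` exploration rounds, of the start of
the controller and of the truncation of the operators, up to a universal constant. -/
def Params.burnInCost (p : Params) (du : ℕ) : ℝ :=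
  p.L * p.R0 ^ 3 * (p.N + p.c * p.m) * (du + Real.log (1 / p.δ) + p.RM ^ 4 * p.Rnat ^ 2)

/-- The estimation term of the regret bound, of second order in `ε`, up to a universal constant and
the factor that depends on `ν`. -/
def Params.estimationCost (p : Params) : ℝ :=
  p.L * p.RM ^ 3 * p.R0 ^ 2 * p.Rnat ^ 2 * p.T * p.ε ^ 2

/-- A bound on the loss of the algorithm in a single round, up to a universal constant. -/
def Params.roundCost (p : Params) (du : ℕ) : ℝ :=
  p.L * p.R0 ^ 2 * p.inputBound du ^ 2

theorem Params.L_mul_inputBound_sq_le {p : Params} (hL : 0 ≤ p.L) (hR : 1 ≤ p.R0) (du : ℕ) :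
    p.L * p.inputBound du ^ 2 ≤ p.roundCost du :=
  mul_le_mul_of_nonneg_right (le_mul_of_one_le_right hL (one_le_pow₀ hR)) (sq_nonneg _)

namespace Params.Admissible

variable {p : Params} (hp : p.Admissible)

include hp

theorem burnInCost_nonneg (hL : 0 ≤ p.L) (hR : 0 ≤ p.R0) (du : ℕ) : 0 ≤ p.burnInCost du := by
  have hlog : 0 ≤ Real.log (1 / p.δ) := hp.log_nonneg
  have hc : 0 ≤ p.c := zero_le_one.trans hp.one_le_c
  unfold burnInCost
  positivity

theorem estimationCost_nonneg (hL : 0 ≤ p.L) : 0 ≤ p.estimationCost := by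
  have hRM : 0 ≤ p.RM := zero_le_one.trans hp.one_le_RM
  unfold estimationCost
  positivity

theorem L_le_roundCost (hL : 0 ≤ p.L) (hR : 1 ≤ p.R0) (du : ℕ) : p.L ≤ p.roundCost du := by
  have one_le_inputBound : 1 ≤ p.inputBound du := by
    linarith [hp.two_mul_Rnat_le_inputBound du, hp.one_le_Rnat]
  exact (le_mul_of_one_le_right hL (one_le_pow₀ one_le_inputBound)).trans
    (L_mul_inputBound_sq_le hL hR du)

theorem mul_roundCost_le_burnInCost (hL : 0 ≤ p.L) (hR : 1 ≤ p.R0) (du : ℕ) :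
    (p.N + p.c) * p.roundCost du ≤ 9 * p.burnInCost du := by
  have hc : 1 ≤ p.c := hp.one_le_c
  have c_le : p.c ≤ p.c * p.m :=
    le_mul_of_one_le_right (by positivity) (Nat.one_le_cast.2 hp.one_le_m)
  calc (p.N + p.c) * p.roundCost du
      ≤ (p.N + p.c * p.m) * (p.L * p.R0 ^ 3
          * (9 * (du + Real.log (1 / p.δ) + p.RM ^ 4 * p.Rnat ^ 2))) := by
        unfold roundCost
        gcongr
        · norm_num
        · exact hp.inputBound_sq_le du
    _ = 9 * p.burnInCost du := by rw [burnInCost]; ring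

theorem mul_deviation_le (hL : 0 ≤ p.L) (hR : 1 ≤ p.R0) (du : ℕ) :
    p.L * (p.Rnat * p.deviation du * p.T) ≤ p.c * p.roundCost du + p.estimationCost := by
  have hT : (0 : ℝ) < p.T := hp.T_pos
  have hc : 1 ≤ p.c := hp.one_le_c
  have hRM : 1 ≤ p.RM := hp.one_le_RM
  have hRn : 1 ≤ p.Rnat := hp.one_le_Rnat
  have hU : 0 < p.inputBound du := hp.inputBound_pos du
  have RM_mul_Rnat_le : p.RM * p.Rnat ≤ p.inputBound du := by
    have : 0 ≤ p.RM * p.Rnat := by positivity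
    exact le_max_of_le_right (by linarith)
  calc p.L * (p.Rnat * p.deviation du * p.T)
      = p.c * (p.L * p.R0 ^ 2 * (p.RM * p.Rnat * p.inputBound du))
          + p.L * p.RM ^ 3 * p.R0 * p.Rnat ^ 2 * p.T * p.ε ^ 2 := by
        rw [deviation]
        field_simp
    _ ≤ p.c * (p.L * p.R0 ^ 2 * (p.inputBound du * p.inputBound du))
          + p.L * p.RM ^ 3 * p.R0 ^ 2 * p.Rnat ^ 2 * p.T * p.ε ^ 2 := by
        gcongr
        exact le_self_pow₀ hR two_ne_zero
    _ = p.c * p.roundCost du + p.estimationCost := by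
        rw [roundCost, estimationCost, sq (p.inputBound du)]

theorem mul_sq_mul_le_estimationCost (hL : 0 ≤ p.L) :
    p.L * ((p.R0 * p.RM * p.ε) ^ 2 * (p.Rnat ^ 2 * p.T)) ≤ p.estimationCost := by
  have hRM : p.RM ^ 2 ≤ p.RM ^ 3 := pow_le_pow_right₀ hp.one_le_RM (by norm_num)
  calc _ = p.L * p.RM ^ 2 * p.R0 ^ 2 * p.Rnat ^ 2 * p.T * p.ε ^ 2 := by ring
    _ ≤ p.estimationCost := by
        unfold estimationCost
        gcongr

theorem div_le_estimationCost_mul (hL : 0 ≤ p.L) (hR : 1 ≤ p.R0) {ν : ℝ} (hν : 0 < ν) :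
    p.L ^ 2 * (p.R0 * p.RM * p.ε) ^ 2 * (p.Rnat ^ 2 * p.T) / ν ≤
      p.estimationCost * (p.L * p.m * p.R0 ^ 2 / ν) := by
  have hm : (1 : ℝ) ≤ p.m := Nat.one_le_cast.2 hp.one_le_m
  have one_le : 1 ≤ p.m * p.R0 ^ 2 := one_le_mul_of_one_le_of_one_le hm (one_le_pow₀ hR)
  have hZ : 0 ≤ p.estimationCost := hp.estimationCost_nonneg hL
  calc _ = p.L * ((p.R0 * p.RM * p.ε) ^ 2 * (p.Rnat ^ 2 * p.T)) * (p.L * 1 / ν) := by ring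
    _ ≤ p.estimationCost * (p.L * (p.m * p.R0 ^ 2) / ν) := by
        gcongr
        exact hp.mul_sq_mul_le_estimationCost hL
    _ = p.estimationCost * (p.L * p.m * p.R0 ^ 2 / ν) := by ring

theorem seven_mul_sqrt_le_cost (hL : 0 ≤ p.L) (hR : 1 ≤ p.R0) {X Y ν : ℝ} (hX : 0 ≤ X)
    (hXle : X ≤ 12 * p.N * p.inputBound du ^ 2) (hY : 0 ≤ Y) (hν : 0 < ν) :
    7 * p.L * √(p.Rnat ^ 2 * p.T * (p.deviation du ^ 2 * p.T
        + (p.R0 * p.RM * p.ε) ^ 2 * (X + Y))) ≤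
      ν * Y + (42 * p.N + 7 * p.c) * p.roundCost du
        + 13 * p.estimationCost * (1 + p.L * p.m * p.R0 ^ 2 / ν) := by
  have hT : (0 : ℝ) < p.T := hp.T_pos
  have hτ : 0 < p.deviation du := hp.deviation_pos hR du
  have hZ : 0 ≤ p.estimationCost := hp.estimationCost_nonneg hL
  have hZν : 0 ≤ p.estimationCost * (p.L * p.m * p.R0 ^ 2 / ν) := by positivity
  have deviation_sq_mul : p.deviation du ^ 2 * p.T = (p.deviation du * √p.T) ^ 2 := by
    rw [mul_pow, Real.sq_sqrt hT.le]
  have sqrt_mul_deviation : √(p.Rnat ^ 2 * p.T) * (p.deviation du * √p.T) =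
      p.Rnat * p.deviation du * p.T := by
    rw [Real.sqrt_mul (sq_nonneg _), Real.sqrt_sq (zero_le_one.trans hp.one_le_Rnat),
      mul_mul_mul_comm, Real.mul_self_sqrt hT.le]
  have balanced := seven_mul_sqrt_le (S := p.Rnat ^ 2 * p.T) (A := p.deviation du * √p.T)
    (κ := p.R0 * p.RM * p.ε) (by positivity) (by positivity) hX hY hL hν
  rw [← deviation_sq_mul, sqrt_mul_deviation] at balanced
  have L_mul_X_le : p.L * X ≤ 12 * p.N * p.roundCost du :=
    calc p.L * X ≤ p.L * (12 * p.N * p.inputBound du ^ 2) := by gcongr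
      _ = 12 * p.N * (p.L * p.inputBound du ^ 2) := by ring
      _ ≤ 12 * p.N * p.roundCost du := by
          gcongr
          exact L_mul_inputBound_sq_le hL hR du
  linarith [hp.mul_deviation_le hL hR du, hp.mul_sq_mul_le_estimationCost hL,
    hp.div_le_estimationCost_mul hL hR hν]

end Params.Admissible

theorem sum_range_eq_sum_range_min_add_sum_Ico (f : ℕ → ℝ) (a T : ℕ) :
    ∑ t ∈ range T, f t = ∑ t ∈ range (min a T), f t + ∑ t ∈ Ico a T, f t := by
  rcases le_total a T with h | h
  · rw [min_eq_left h, sum_range_add_sum_Ico f h]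
  · rw [min_eq_right h, Ico_eq_empty_of_le h, sum_empty, add_zero]

section ControlRegret

variable {P : Instance dx ds dy du dη} {p : Params}

theorem exists_mem_sum_loss_le (hP : P.Regular p) {Pi : Set (LDC dy du)} (hPi : Pi.Nonempty) :
    ∃ π ∈ Pi, ∑ t ∈ range p.T, P.loss t (P.ldcV π t) ≤
      sInf ((fun π => ∑ t ∈ range p.T, P.loss t (P.ldcV π t)) '' Pi) + p.L := by
  rcases (hP.loss 0).const_nonneg.eq_or_lt with hL | hL
  · obtain ⟨π, hπ⟩ := hPi
    have loss_eq_zero (t : ℕ) (v : VecYU dy du) : P.loss t v = 0 :=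
      le_antisymm (by simpa only [← hL, zero_mul] using (hP.loss t).le v) ((hP.loss t).nonneg v)
    refine ⟨π, hπ, ?_⟩
    simp only [loss_eq_zero, sum_const_zero, ← hL, add_zero]
    exact Real.sInf_nonneg (Set.forall_mem_image.2 fun _ _ => le_rfl)
  · obtain ⟨_, ⟨π, hπ, rfl⟩, hlt⟩ := Real.lt_sInf_add_pos (hPi.image _) hL
    exact ⟨π, hπ, hlt.le⟩

theorem controlRegret_eq_zero_of_dim_eq_zero {P : Instance dx ds dy 0 dη} {R : ℝ} {ψ : ℕ → ℝ}
    (hPi : (P.policyClass R ψ).Nonempty) (T : ℕ) (u : ℕ → Vec 0) :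
    P.controlRegret T u (P.policyClass R ψ) = 0 := by
  have conv_eq_zero (x : ℕ → Vec 0) : P.Gv ⋆ x = 0 := by
    rw [Subsingleton.elim x 0, map_zero]
  have cost_eq : ∀ π ∈ P.policyClass R ψ, ∑ t ∈ range T, P.loss t (P.ldcV π t) =
      ∑ t ∈ range T, P.loss t (P.vNat t) := by
    rintro π ⟨Gc, hGc, -⟩
    rw [ldcV_eq_vNat_add_conv hGc, conv_eq_zero, add_zero]
  rw [Instance.controlRegret, Set.image_congr cost_eq, hPi.image_const, csInf_singleton,
    v_eq_vNat_add_conv, conv_eq_zero, add_zero, sub_self]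

theorem controlRegret_le_memoryRegret_add {m : ℕ} (hloss : ∀ t v, 0 ≤ P.loss t v)
    {Pi : Set (LDC dy du)} {π : LDC dy du} {T : ℕ} {r : ℝ}
    (hπ : ∑ t ∈ range T, P.loss t (P.ldcV π t) ≤
      sInf ((fun π => ∑ t ∈ range T, P.loss t (P.ldcV π t)) '' Pi) + r)
    (h a : ℕ) (u : ℕ → Vec du) (x : ℕ → Vec dη) (z : ℕ → ParamVec m du dη)
    (zstar : ParamVec m du dη) :
    P.controlRegret T u Pi ≤ P.memoryRegret h a T x z zstar
      + ∑ t ∈ range (min a T), P.loss t (P.v u t)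
      + ∑ t ∈ Ico a T, (P.loss t (P.v u t) - P.memLoss h x t z)
      + ∑ t ∈ Ico a T, (P.memLoss h x t (fun _ => zstar) - P.loss t (P.ldcV π t)) + r := by
  have head_nonneg : 0 ≤ ∑ t ∈ range (min a T), P.loss t (P.ldcV π t) :=
    sum_nonneg fun t _ => hloss t _
  rw [sum_range_eq_sum_range_min_add_sum_Ico _ a] at hπ
  rw [Instance.controlRegret, sum_range_eq_sum_range_min_add_sum_Ico _ a, Instance.memoryRegret,
    sum_sub_distrib, sum_sub_distrib]
  linarith

end ControlRegret

section Rounds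

variable {P : Instance dx ds dy du dη} {p : Params} {u : ℕ → Vec du} {x : ℕ → Vec dη}

theorem Params.Admissible.inputBound_le_mul (hp : p.Admissible) (hR : 1 ≤ p.R0) (du : ℕ) :
    p.inputBound du ≤ p.R0 * p.inputBound du :=
  le_mul_of_one_le_left (hp.inputBound_pos du).le hR

theorem Params.Admissible.one_le_two_mul_inputBound (hp : p.Admissible) (hR : 1 ≤ p.R0) (du : ℕ) :
    1 ≤ 2 * (p.R0 * p.inputBound du) := by
  linarith [hp.inputBound_le_mul hR du, hp.two_mul_Rnat_le_inputBound du, hp.one_le_Rnat]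

theorem norm_vNat_add_conv_le (hp : p.Admissible) (hP : P.Regular p) (hR : 1 ≤ p.R0)
    (hu : ∀ t, ‖u t‖ ≤ p.inputBound du) {G : ℕ → Matrix (Fin dy ⊕ Fin du) (Fin du) ℝ}
    (hG : L1opLE G p.R0) (t : ℕ) : ‖P.vNat t + (G ⋆ u) t‖ ≤ 2 * (p.R0 * p.inputBound du) := by
  have norm_add_le := norm_add_le_of_le (hP.vNat_le t) (hG.norm_conv_le hu t)
  linarith [hp.inputBound_le_mul hR du, hp.two_mul_Rnat_le_inputBound du, hp.one_le_Rnat]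

theorem sum_range_loss_v_le (hp : p.Admissible) (hP : P.Regular p) (hR : 1 ≤ p.R0)
    (hu : ∀ t, ‖u t‖ ≤ p.inputBound du) (n : ℕ) :
    ∑ t ∈ range n, P.loss t (P.v u t) ≤ n * (4 * p.roundCost du) :=
  calc ∑ t ∈ range n, P.loss t (P.v u t)
      ≤ ∑ _t ∈ range n, p.L * (2 * (p.R0 * p.inputBound du)) ^ 2 := by
        refine sum_le_sum fun t _ =>
          (hP.loss t).le_of_norm_le (hp.one_le_two_mul_inputBound hR du) ?_
        rw [v_eq_vNat_add_conv]
        exact norm_vNat_add_conv_le hp hP hR hu hP.Gv.l1opLE t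
    _ = n * (4 * p.roundCost du) := by
        rw [sum_const, card_range, nsmul_eq_mul, Params.roundCost]
        ring

theorem sum_range_norm_sub_drcInput_sq_le (hu : ∀ t, ‖u t‖ ≤ p.inputBound du)
    (hx : ∀ t, ‖x t‖ ≤ 2 * p.Rnat) {M : Fin p.m → Matrix (Fin du) (Fin dη) ℝ}
    (hM : M ∈ drcClass du dη p.m p.RM) (n : ℕ) :
    ∑ t ∈ range n, ‖u t - drcInput M x t‖ ^ 2 ≤ n * (4 * p.inputBound du ^ 2) :=
  calc ∑ t ∈ range n, ‖u t - drcInput M x t‖ ^ 2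
      ≤ ∑ _t ∈ range n, (p.inputBound du + p.inputBound du) ^ 2 := by
        gcongr with t
        exact norm_sub_le_of_le (hu t) (norm_drcInput_le_inputBound hx hM t)
    _ = n * (4 * p.inputBound du ^ 2) := by
        rw [sum_const, card_range, nsmul_eq_mul]
        ring

variable {M : ℕ → Fin p.m → Matrix (Fin du) (Fin dη) ℝ}

theorem loss_v_sub_memLoss_le (hp : p.Admissible) (hP : P.Regular p) (hR : 1 ≤ p.R0)
    (hu : ∀ t, ‖u t‖ ≤ p.inputBound du) (hux : ∀ t, p.N ≤ t → u t = drcInput (M t) x t) {t : ℕ}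
    (ht : p.N + p.h ≤ t) :
    P.loss t (P.v u t) - P.memLoss p.h x t (fun s => embed (M s)) ≤
      p.L * (2 * (p.R0 * p.inputBound du)) * (p.c * p.R0 / p.T * p.inputBound du) := by
  have hL : 0 ≤ p.L := (hP.loss 0).const_nonneg
  have hB : 1 ≤ 2 * (p.R0 * p.inputBound du) := hp.one_le_two_mul_inputBound hR du
  have inputs_eq : (trunc (p.h + 1) P.Gv ⋆ fun s => drcInput (M s) x s) t =
      (trunc (p.h + 1) P.Gv ⋆ u) t := by
    rw [conv_trunc, conv_trunc]
    refine sum_congr rfl fun i hi => ?_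
    rw [hux (t - i) (by have := mem_range.1 hi; omega)]
  have sub_eq : P.vNat t + (P.Gv ⋆ u) t - (P.vNat t + (trunc (p.h + 1) P.Gv ⋆ u) t) =
      (tail (p.h + 1) P.Gv ⋆ u) t := by
    nth_rw 1 [← trunc_add_tail (p.h + 1) P.Gv]
    rw [map_add, LinearMap.add_apply, Pi.add_apply]
    abel
  rw [memLoss_embed, inputs_eq, v_eq_vNat_add_conv, Pi.add_apply]
  refine ((hP.loss t).sub_le_of_norm_le hB
    (norm_vNat_add_conv_le hp hP hR hu hP.Gv.l1opLE t)
    (norm_vNat_add_conv_le hp hP hR hu (hP.Gv.l1opLE.trunc _) t)).trans ?_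
  rw [sub_eq]
  gcongr
  exact (hP.Gv.l1opLE_tail hp.ψ0_le).norm_conv_le hu t

theorem sum_loss_v_sub_memLoss_le (hp : p.Admissible) (hP : P.Regular p) (hR : 1 ≤ p.R0)
    (hu : ∀ t, ‖u t‖ ≤ p.inputBound du) (hux : ∀ t, p.N ≤ t → u t = drcInput (M t) x t) {a : ℕ}
    (ha : p.N + p.h ≤ a) :
    ∑ t ∈ Ico a p.T, (P.loss t (P.v u t) - P.memLoss p.h x t (fun s => embed (M s))) ≤
      2 * p.c * p.roundCost du := by
  have hT : (0 : ℝ) < p.T := hp.T_pos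
  have hL : 0 ≤ p.L := (hP.loss 0).const_nonneg
  have hc : 1 ≤ p.c := hp.one_le_c
  have hU : 0 < p.inputBound du := hp.inputBound_pos du
  calc _ ≤ #(Ico a p.T) • (p.L * (2 * (p.R0 * p.inputBound du))
          * (p.c * p.R0 / p.T * p.inputBound du)) :=
        sum_le_card_nsmul _ _ _ fun t ht =>
          loss_v_sub_memLoss_le hp hP hR hu hux (ha.trans (mem_Ico.1 ht).1)
    _ ≤ p.T * (p.L * (2 * (p.R0 * p.inputBound du)) * (p.c * p.R0 / p.T * p.inputBound du)) := by
        rw [nsmul_eq_mul]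
        gcongr
        simp
    _ = 2 * p.c * p.roundCost du := by
        rw [Params.roundCost]
        field_simp

end Rounds

section Main

variable {P : Instance dx ds dy du dη} {p : Params} {ξ : ℕ → Vec du}
  {Ghat : ℕ → Matrix (Fin dη) (Fin du) ℝ} {u : ℕ → Vec du} {x : ℕ → Vec dη}
  {M : ℕ → Fin p.m → Matrix (Fin du) (Fin dη) ℝ} {a : ℕ}

theorem sum_norm_embedY_act_sq_eq (hux : ∀ t, p.N ≤ t → u t = drcInput (M t) x t) (ha : p.N ≤ a)
    (Mstar : Fin p.m → Matrix (Fin du) (Fin dη) ℝ) :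
    ∑ t ∈ Ico a p.T, ‖embedY p.m du x t *ₑ (embed (M t) - embed Mstar)‖ ^ 2 =
      ∑ t ∈ Ico a p.T, ‖u t - drcInput Mstar x t‖ ^ 2 := by
  refine sum_congr rfl fun t ht => ?_
  rw [act_sub, embedY_act_embed, embedY_act_embed, hux t (ha.trans (mem_Ico.1 ht).1)]

theorem exists_controlRegret_le_of_bounded (hp : p.Admissible) (hP : P.Regular p) (hR : 1 ≤ p.R0)
    (hPi : (P.policyClass p.Rstar p.ψstar).Nonempty) (hη : IsMarkovEstimate p.h p.ε P.Gη Ghat)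
    (hε : p.ε * (2 * p.RM) ≤ 1) (hu : ∀ t, ‖u t‖ ≤ p.inputBound du) (hx : x = P.ηHat Ghat u)
    (hxb : ∀ t, ‖x t‖ ≤ 2 * p.Rnat) (hux : ∀ t, p.N ≤ t → u t = drcInput (M t) x t)
    (ha : p.N + p.h ≤ a) (haN : a ≤ 3 * p.N) :
    ∃ zstar ∈ embed '' drcClass du dη p.m p.RM, ∀ ν : ℝ, 0 < ν →
      P.controlRegret p.T u (P.policyClass p.Rstar p.ψstar) ≤
        P.memoryRegret p.h a p.T x (fun t => embed (M t)) zstar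
        + ν * ∑ t ∈ Ico a p.T, ‖embedY p.m du x t *ₑ (embed (M t) - zstar)‖ ^ 2
        + 500 * p.burnInCost du
        + 500 * p.estimationCost * (1 + p.L * p.m * p.R0 ^ 2 / ν) := by
  obtain ⟨π, hπ, hπle⟩ := exists_mem_sum_loss_le hP hPi
  obtain ⟨Mstar, hMstar, comparator_le⟩ :=
    exists_mem_drcClass_sum_memLoss_sub_le hp hP hR hη hε hu hx hxb hπ a
  refine ⟨embed Mstar, ⟨Mstar, hMstar, rfl⟩, fun ν hν => ?_⟩
  have hL : 0 ≤ p.L := (hP.loss 0).const_nonneg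
  have head_le : ((min a p.T : ℕ) : ℝ) ≤ 3 * p.N := mod_cast (min_le_left a p.T).trans haN
  have hE : 0 ≤ p.roundCost du := hL.trans (hp.L_le_roundCost hL hR du)
  have burnIn_le : ∑ t ∈ range (min a p.T), P.loss t (P.v u t) ≤ 12 * p.N * p.roundCost du := by
    have := mul_le_mul_of_nonneg_right head_le (mul_nonneg zero_le_four hE)
    linarith [sum_range_loss_v_le hp hP hR hu (min a p.T)]
  have burnIn_dist_le : ∑ t ∈ range (min a p.T), ‖u t - drcInput Mstar x t‖ ^ 2 ≤
      12 * p.N * p.inputBound du ^ 2 := by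
    have := mul_le_mul_of_nonneg_right head_le
      (mul_nonneg zero_le_four (sq_nonneg (p.inputBound du)))
    linarith [sum_range_norm_sub_drcInput_sq_le hu hxb hMstar (min a p.T)]
  have cost_le := hp.seven_mul_sqrt_le_cost hL hR (sum_nonneg fun _ _ => sq_nonneg _)
    burnIn_dist_le (sum_nonneg fun t (_ : t ∈ Ico a p.T) => sq_nonneg ‖u t - drcInput Mstar x t‖) hν
  rw [inputDist, sum_range_eq_sum_range_min_add_sum_Ico _ a] at comparator_le
  rw [sum_norm_embedY_act_sq_eq hux (le_self_add.trans ha)]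
  have decomposition := controlRegret_le_memoryRegret_add (fun t => (hP.loss t).nonneg) hπle p.h a
    u x (fun t => embed (M t)) (embed Mstar)
  have truncation_le := sum_loss_v_sub_memLoss_le hp hP hR hu hux ha
  have hZ : 0 ≤ p.estimationCost * (1 + p.L * p.m * p.R0 ^ 2 / ν) :=
    mul_nonneg (hp.estimationCost_nonneg hL) (by positivity)
  have N_mul_roundCost_nonneg : 0 ≤ p.N * p.roundCost du := by positivity
  have roundCost_le : p.roundCost du ≤ p.c * p.roundCost du := le_mul_of_one_le_left hE hp.one_le_c
  linarith [hp.L_le_roundCost hL hR du, hp.mul_roundCost_le_burnInCost hL hR du,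
    hp.burnInCost_nonneg hL (zero_le_one.trans hR) du]

theorem exists_controlRegret_le (hp : p.Admissible) (hP : P.Regular p)
    (hPi : (P.policyClass p.Rstar p.ψstar).Nonempty)
    (hM : ∀ t, M t ∈ drcClass du dη p.m p.RM) (hξ : GoodExploration p ξ)
    (hη : IsMarkovEstimate p.h p.ε P.Gη Ghat) (hu : u = P.algInput p.N ξ Ghat M)
    (hx : x = P.ηHat Ghat u) (ha : a = p.N + p.m + 2 * p.h) :
    ∃ zstar ∈ embed '' drcClass du dη p.m p.RM, ∀ ν : ℝ, 0 < ν →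
      P.controlRegret p.T u (P.policyClass p.Rstar p.ψstar) ≤
        P.memoryRegret p.h a p.T x (fun t => embed (M t)) zstar
        + ν * ∑ t ∈ Ico a p.T, ‖embedY p.m du x t *ₑ (embed (M t) - zstar)‖ ^ 2
        + 500 * p.burnInCost du
        + 500 * p.estimationCost * (1 + p.L * p.m * p.R0 ^ 2 / ν) := by
  have hL : 0 ≤ p.L := (hP.loss 0).const_nonneg
  rcases eq_or_ne du 0 with rfl | hdu
  · refine ⟨embed (M 0), ⟨M 0, hM 0, rfl⟩, fun ν hν => ?_⟩
    have memoryRegret_eq_zero :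
        P.memoryRegret p.h a p.T x (fun t => embed (M t)) (embed (M 0)) = 0 := by
      rw [Instance.memoryRegret, Subsingleton.elim (fun t => embed (M t)) fun _ => embed (M 0),
        sub_self]
    have hW : 0 ≤ p.burnInCost 0 := hp.burnInCost_nonneg hL hP.Gv.l1opLE.nonneg 0
    have hZ : 0 ≤ p.estimationCost := hp.estimationCost_nonneg hL
    rw [controlRegret_eq_zero_of_dim_eq_zero hPi, memoryRegret_eq_zero]
    positivity
  have hR : 1 ≤ p.R0 := one_le_of_isStableOperator_Gv hP.Gv hdu
  have hε : p.ε * (2 * p.RM) ≤ 1 := hξ.ε_mul_RM_le_one hp hR (l1opLE_estimationError hη).nonneg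
  have norm_u_le : ∀ t, ‖u t‖ ≤ p.inputBound du := hu ▸ norm_algInput_le hp hP hξ hη hR hM
  have norm_x_le : ∀ t, ‖x t‖ ≤ 2 * p.Rnat :=
    hx ▸ norm_ηHat_le_two_mul_Rnat hp hP hξ hη hR norm_u_le
  have hux : ∀ t, p.N ≤ t → u t = drcInput (M t) x t := fun t ht => by
    rw [hx, hu]
    exact algInput_of_le ht
  have hN : p.m + p.h ≤ p.N := hp.N_ge
  exact exists_controlRegret_le_of_bounded hp hP hR hPi hη hε norm_u_le hx norm_x_le hux
    (by omega) (by omega)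

end Main

end NonstochasticControl

end

open NonstochasticControl in
theorem mainTheorem8 :
    ∃ K₀ : ℝ, 0 < K₀ ∧
      -- dynamic nominal controller
      (∀ (dx ds dy du dη : ℕ) (P : Instance dx ds dy du dη) (p : Params)
        (ξ : ℕ → Vec du)
        (Ghatv : ℕ → Matrix (Fin dy ⊕ Fin du) (Fin du) ℝ)
        (Ghatη : ℕ → Matrix (Fin dη) (Fin du) ℝ)
        (M : ℕ → Fin p.m → Matrix (Fin du) (Fin dη) ℝ),
        p.Admissible → P.Regular p →
        (P.policyClass p.Rstar p.ψstar).Nonempty →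
        (∀ t, M t ∈ drcClass du dη p.m p.RM) →
        GoodExploration p ξ →
        IsMarkovEstimate p.h p.ε P.Gv Ghatv →
        IsMarkovEstimate p.h p.ε P.Gη Ghatη →
        ∀ (uex : ℕ → Vec du) (ηhat : ℕ → Vec dη) (t₀ : ℕ),
        uex = P.algInput p.N ξ Ghatη M →
        ηhat = P.ηHat Ghatη uex →
        t₀ = p.N + p.m + 2 * p.h →
        ∃ zstar ∈ embed '' drcClass du dη p.m p.RM, ∀ ν : ℝ, 0 < ν →
          P.controlRegret p.T uex (P.policyClass p.Rstar p.ψstar) ≤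
            P.memoryRegret p.h t₀ p.T ηhat (fun t => embed (M t)) zstar
            + ν * ∑ t ∈ Finset.Ico t₀ p.T,
                ‖embedY p.m du ηhat t *ₑ (embed (M t) - zstar)‖ ^ 2
            + K₀ * (p.L * p.R0 ^ 3 * (p.N + p.c * p.m))
                * (du + Real.log (1 / p.δ) + p.RM ^ 4 * p.Rnat ^ 2)
            + K₀ * (p.L * p.RM ^ 3 * p.R0 ^ 2 * p.Rnat ^ 2 * p.T * p.ε ^ 2)
                * (1 + p.L * p.m * p.R0 ^ 2 / ν)) ∧
      -- static nominal controller: one estimate `Ghat` of `G_K`, whose `y`-rows reconstruct `y^K`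
      (∀ (dx dy du : ℕ) (K : Matrix (Fin du) (Fin dy) ℝ) (P : Instance dx 0 dy du dy) (p : Params)
        (ξ : ℕ → Vec du)
        (Ghat : ℕ → Matrix (Fin dy ⊕ Fin du) (Fin du) ℝ)
        (M : ℕ → Fin p.m → Matrix (Fin du) (Fin dy) ℝ),
        P.ctrl = NominalController.static K →
        p.Admissible → P.Regular p →
        (P.policyClass p.Rstar p.ψstar).Nonempty →
        (∀ t, M t ∈ drcClass du dy p.m p.RM) →
        GoodExploration p ξ →
        IsMarkovEstimate p.h p.ε P.Gv Ghat →
        ∀ (uex : ℕ → Vec du) (ηhat : ℕ → Vec dy) (t₀ : ℕ),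
        uex = P.algInput p.N ξ (fun i => (Ghat i).toRows₁) M →
        ηhat = P.ηHat (fun i => (Ghat i).toRows₁) uex →
        t₀ = p.N + p.m + 2 * p.h →
        ∃ zstar ∈ embed '' drcClass du dy p.m p.RM, ∀ ν : ℝ, 0 < ν →
          P.controlRegret p.T uex (P.policyClass p.Rstar p.ψstar) ≤
            P.memoryRegret p.h t₀ p.T ηhat (fun t => embed (M t)) zstar
            + ν * ∑ t ∈ Finset.Ico t₀ p.T,
                ‖embedY p.m du ηhat t *ₑ (embed (M t) - zstar)‖ ^ 2
            + K₀ * (p.L * p.R0 ^ 3 * (p.N + p.c * p.m))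
                * (du + Real.log (1 / p.δ) + p.RM ^ 4 * p.Rnat ^ 2)
            + K₀ * (p.L * p.RM ^ 3 * p.R0 ^ 2 * p.Rnat ^ 2 * p.T * p.ε ^ 2)
                * (1 + p.L * p.m * p.R0 ^ 2 / ν)) := by
  refine ⟨500, by norm_num, ?_, ?_⟩
  · intro dx ds dy du dη P p ξ Ghatv Ghatη M hp hP hPi hM hξ _ hη uex ηhat t₀ huex hηhat ht₀
    simpa only [Params.burnInCost, Params.estimationCost, mul_assoc] using
      exists_controlRegret_le hp hP hPi hM hξ hη huex hηhat ht₀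
  · intro dx dy du K P p ξ Ghat M hK hp hP hPi hM hξ hG uex ηhat t₀ huex hηhat ht₀
    have hη : IsMarkovEstimate p.h p.ε P.Gη (fun i => (Ghat i).toRows₁) := by
      rw [Gη_eq_toRows₁_Gv hK]
      exact hG.toRows₁
    simpa only [Params.burnInCost, Params.estimationCost, mul_assoc] using
      exists_controlRegret_le hp hP hPi hM hξ hη huex hηhat ht₀
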